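/- Let $\rho$ be a state of $N$ qubits (a positive semidefinite operator on $(\mathbb{C}^2)^{\otimes N}$ with trace $1$), let $A,B\subseteq\{1,\dots,N\}$ be disjoint, put $AB=A\cup B$, and let $\rho_{AB}=\mathrm{Tr}_{\neg AB}(\rho)$ be the reduced state. Write $X^{T_A}$ for the partial transpose of an operator $X$ on $AB$ in the computational basis, $(|k_A,k_B\rangle\langle l_A,l_B|)^{T_A}=|l_A,k_B\rangle\langle k_A,l_B|$, and $p_n=\mathrm{Tr}\big((\rho_{AB}^{T_A})^n\big)$. Perform $M$ independent runs of the following experiment on $\rho$: draw independent single-qubit unitaries $u_1,\dots,u_N$, each from a unitary $3$-design (a probability measure on $U(2)$ with the same value of $\mathbb{E}[U^{\otimes 3}\otimes\bar U^{\otimes 3}]$ as Haar measure), let $u=u_1\otimes\cdots\otimes u_N$, and measure $u\rho u^\dagger$ in the computational basis, so that $k\in\{0,1\}^N$ is obtained with probability $\langle k|u\rho u^\dagger|k\rangle$. The $r$-th run gives the snapshot $$\hat\rho_r=\bigotimes_{i\in AB}\Big[3\,(u_i^{(r)})^\dagger|k_i^{(r)}\rangle\langle k_i^{(r)}|u_i^{(r)}-\mathbb{I}_2\Big],\qquad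 r=1,\dots,M.$$ For matrices $X_1,\dots,X_M$ let $$\mathcal{U}(X_1,\dots,X_M)=\binom{M}{3}^{-1}\sum_{i<j<k}\mathrm{Tr}\Big(\tfrac{1}{3!}\sum_{\pi\in\mathcal{S}_3}X_{\pi(i)}X_{\pi(j)}X_{\pi(k)}\Big),$$ where $\pi$ runs over the permutations of $\{i,j,k\}$ (and $\mathcal{U}=0$ if $M<3$), and put $\hat p_3=\mathcal{U}(\hat\rho_1^{T_A},\dots,\hat\rho_M^{T_A})$ and $\hat s_3=\mathcal{U}(\hat\rho_1,\dots,\hat\rho_M)$. Let $\epsilon,\delta>0$. If $$M\ \ge\ 39\,\max\left\{\frac{2^{|AB|}p_2^2}{\epsilon^2\delta},\ \frac{2^{1.5|AB|}p_2}{\epsilon\sqrt{\delta}},\ \frac{2^{2|AB|}}{\epsilon^{2/3}\delta^{1/3}}\right\},$$ then $|\hat p_3-p_3|\le\epsilon$ with probability at least $1-\delta$, and likewise $|\hat s_3-\mathrm{Tr}(\rho_{AB}^3)|\le\epsilon$ with probability at least $1-\delta$. -/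

import Mathlib

open MeasureTheory Matrix
open scoped BigOperators

noncomputable section

open scoped ComplexOrder

namespace ClassicalShadow

/-! ### Single-qubit unitaries, Haar measure, unitary 3-designs -/

/-- Single-qubit unitaries, the group `U(2)`. -/
abbrev U2 : Type := Matrix.unitaryGroup (Fin 2) ℂ

instance instMeasurableSpaceU2 : MeasurableSpace U2 := borel U2

instance instBorelSpaceU2 : BorelSpace U2 := ⟨rfl⟩

instance instCompactSpaceU2 : CompactSpace U2 := by
  have hclosed : IsClosed (Matrix.unitaryGroup (Fin 2) ℂ : Set (Matrix (Fin 2) (Fin 2) ℂ)) := by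
    have h : (Matrix.unitaryGroup (Fin 2) ℂ : Set (Matrix (Fin 2) (Fin 2) ℂ))
        = {A | A * star A = 1} := by
      ext A
      exact Matrix.mem_unitaryGroup_iff
    rw [h]
    exact isClosed_eq (by fun_prop) continuous_const
  have hK : IsCompact (Set.pi Set.univ fun _ : Fin 2 => Set.pi Set.univ fun _ : Fin 2 =>
      Metric.closedBall (0 : ℂ) 1) :=
    isCompact_univ_pi fun _ => isCompact_univ_pi fun _ => isCompact_closedBall 0 1
  refine isCompact_iff_compactSpace.mp (hK.of_isClosed_subset hclosed ?_)
  intro A hA i _ j _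
  simpa using entry_norm_bound_of_unitary hA i j

/-- The Haar probability measure on `U(2)`. -/
def haarU2 : Measure U2 := Measure.haarMeasure ⊤

/-- A probability measure `ν` on `U(2)` is a unitary 3-design if it reproduces the third moments
of the Haar measure: `𝔼_ν [U^{⊗3} ⊗ Ū^{⊗3}] = 𝔼_Haar [U^{⊗3} ⊗ Ū^{⊗3}]`, entry by entry. -/
def IsUnitaryThreeDesign (ν : Measure U2) : Prop :=
  IsProbabilityMeasure ν ∧
    ∀ a b c d : Fin 3 → Fin 2,
      ∫ U : U2, ∏ t, (U.1 (a t) (b t) * star (U.1 (c t) (d t))) ∂ν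
        = ∫ U : U2, ∏ t, (U.1 (a t) (b t) * star (U.1 (c t) (d t))) ∂haarU2

/-! ### Multi-qubit operators -/

/-- Operators on qubits labelled by `ι`, as matrices in the computational basis
`|x⟩`, `x : ι → {0, 1}`. -/
abbrev Op (ι : Type) : Type := Matrix (ι → Fin 2) (ι → Fin 2) ℂ

/-- The tensor product `⨂ i, m i` of single-qubit operators. -/
def tensor {ι : Type} [Fintype ι] (m : ι → Matrix (Fin 2) (Fin 2) ℂ) : Op ι :=
  Matrix.of fun x y => ∏ i, m i (x i) (y i)

/-- Density matrices. -/
def IsState {ι : Type} [Fintype ι] [DecidableEq ι] (ρ : Op ι) : Prop :=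
  ρ.PosSemidef ∧ ρ.trace = 1

/-- The basis label which is `x` on the qubits in `S` and `z` on the others. -/
def glue {ι : Type} [DecidableEq ι] (S : Finset ι) (x : S → Fin 2)
    (z : {i // i ∉ S} → Fin 2) : ι → Fin 2 :=
  fun i => if h : i ∈ S then x ⟨i, h⟩ else z ⟨i, h⟩

/-- The reduced operator on the qubits in `S`: the partial trace over all other qubits. -/
def reduced {ι : Type} [Fintype ι] [DecidableEq ι] (S : Finset ι) (ρ : Op ι) : Op S :=
  Matrix.of fun x y => ∑ z : {i // i ∉ S} → Fin 2, ρ (glue S x z) (glue S y z)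

/-- The partial transpose `X ↦ X^{T_A}` of an operator on the qubits in `S`, with respect to the
qubits which belong to `A`: `(|k_A k_B⟩⟨l_A l_B|)^{T_A} = |l_A k_B⟩⟨k_A l_B|`. -/
def partialTranspose {ι : Type} [DecidableEq ι] {S : Finset ι} (A : Finset ι) (X : Op S) : Op S :=
  Matrix.of fun x y =>
    X (fun i => if i.1 ∈ A then y i else x i) (fun i => if i.1 ∈ A then x i else y i)

/-! ### Randomized measurements and classical shadows -/

/-- The record of one run on qubits `ι`: the single-qubit unitaries and the measured bits. -/
abbrev Record (ι : Type) : Type := (ι → U2) × (ι → Fin 2)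

/-- Born probability `⟨k| u ρ u† |k⟩` of the outcome `k`, where `u = ⨂ i, u_i`. -/
def bornProb {ι : Type} [Fintype ι] [DecidableEq ι] (ρ : Op ι) (s : Record ι) : ℝ :=
  ((tensor fun i => (s.1 i).1) * ρ * (tensor fun i => (s.1 i).1)ᴴ) s.2 s.2 |>.re

/-- Law of one run: the `u_i` are independent, `u_i` has law `ν i`, and, given `u`, the outcome `k`
has probability `bornProb ρ (u, k)`. -/
def runLaw {ι : Type} [Fintype ι] [DecidableEq ι] (ν : ι → Measure U2) (ρ : Op ι) :
    Measure (Record ι) :=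
  ((Measure.pi ν).prod Measure.count).withDensity fun s => ENNReal.ofReal (bornProb ρ s)

/-- Law of the data from `M` independent runs. -/
def dataLaw {ι : Type} [Fintype ι] [DecidableEq ι] (ν : ι → Measure U2) (ρ : Op ι) (M : ℕ) :
    Measure (Fin M → Record ι) :=
  Measure.pi fun _ => runLaw ν ρ

/-- The snapshot `⨂ i ∈ S, (3 u_i† |k_i⟩⟨k_i| u_i - 𝕀)` of the subsystem `S`. -/
def snapshot {ι : Type} (S : Finset ι) (s : Record ι) : Op S :=
  tensor fun i : S =>
    (3 : ℂ) • ((s.1 i).1ᴴ * Matrix.single (s.2 i) (s.2 i) 1 * (s.1 i).1) - 1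

/-- The cubic U-statistic (equal to `0` if `M < 3`, where there are no triples)
`(M choose 3)⁻¹ ∑_{i<j<k} Tr ((1/3!) ∑_{π ∈ S₃} X_{π(i)} X_{π(j)} X_{π(k)})`
of the matrices `X_1, …, X_M`. -/
def cubicUStat {κ : Type} [Fintype κ] {M : ℕ} (X : Fin M → Matrix κ κ ℂ) : ℂ :=
  ((M.choose 3 : ℕ) : ℂ)⁻¹ *
    ∑ t : Fin 3 → Fin M with t 0 < t 1 ∧ t 1 < t 2,
      (((1 : ℂ) / 6) • ∑ π : Equiv.Perm (Fin 3),
        X (t (π 0)) * X (t (π 1)) * X (t (π 2))).trace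

/-- The PT-moment `Tr ((ρ_S^{T_A})^n)` of the reduced state on `S`. -/
def ptMoment {ι : Type} [Fintype ι] [DecidableEq ι] (A S : Finset ι) (ρ : Op ι) (n : ℕ) : ℂ :=
  ((partialTranspose A (reduced S ρ)) ^ n).trace

/-- The estimator of the third PT-moment from the data of `M` runs. -/
def p3Estimator {ι : Type} [DecidableEq ι] (A S : Finset ι) {M : ℕ}
    (s : Fin M → Record ι) : ℂ :=
  cubicUStat fun r => partialTranspose A (snapshot S (s r))

/-- The estimator of `Tr (ρ_S ^ 3)` from the data of `M` runs. -/
def s3Estimator {ι : Type} [DecidableEq ι] (S : Finset ι) {M : ℕ}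
    (s : Fin M → Record ι) : ℂ :=
  cubicUStat fun r => snapshot S (s r)

end ClassicalShadow

end

/-! Write each partially transposed snapshot as `R + Δ_r`, where `R` is the partial transpose of the
reduced state and the `Δ_r` are independent with mean zero. The U-statistic is the average of `Tr
(X_i X_j X_k)` over ordered triples of distinct indices, so expanding the product gives its
Hoeffding decomposition: the error is 3 times the average of `Tr (R² Δ_i)`, plus 3 times the average
of `Tr (R Δ_i Δ_j)`, plus the average of `Tr (Δ_i Δ_j Δ_k)` (`p3Estimator_sub_eq`). Chebyshev's
inequality then reduces the claim to second moments of these three averages.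

The probabilistic input is one operator inequality: the covariance matrix of the entries of a
snapshot on `n` qubits is at most `2 ^ n` (`isCentered_snapshotDeviation`). It is proved qubit by
qubit. After one state index is adjoined on either side, the second moments of a single-qubit
snapshot form an explicit 8 × 8 matrix with spectrum in [0, 2], the same for every 3-design. Tensor
products of such matrices lie between 0 and `2 ^ n`, and an arbitrary, possibly entangled, state is
absorbed into the vector on which the tensor product is evaluated
(`re_sum_mul_prod_secondMoment_le`).

If the covariance is at most `c`, a form of degree `d` with coefficients `H`, evaluated at distinct
sample points, has second moment at most `c ^ d * ‖H‖²`, since independence replaces the covariance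
by its tensor power. Forms at tuples with different ranges are uncorrelated, so averaging over
distinct tuples gains a factor of order `M ^ d`. With `c = 2 ^ n`, the squared coefficient norms are
at most `p₂ ^ 2`, `c * p₂` and `c ^ 3` in degrees 1, 2 and 3. Hence the three contributions are of
order `c p₂² / M`, `c³ p₂ / M²` and `c⁶ / M³`; the middle one is controlled by the geometric mean of
the conditions for the outer two.

Partial transposition only permutes matrix entries. It therefore preserves the Frobenius norm, so
`p₂` does not depend on `A`, and the claim about `Tr (ρ_AB³)` is the case `A = ∅`. -/

noncomputable section

open scoped ComplexOrder

namespace ClassicalShadow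

/-! ### Operator bounds for tensor products -/

/-- The matrix of a tensor product of matrices. -/
def piTensor {ι J : Type*} [Fintype ι] (m : ι → Matrix J J ℂ) : Matrix (ι → J) (ι → J) ℂ :=
  Matrix.of fun p q => ∏ i, m i (p i) (q i)

lemma piTensor_mul {ι J : Type*} [Fintype ι] [DecidableEq ι] [Fintype J]
    (m m' : ι → Matrix J J ℂ) :
    piTensor m * piTensor m' = piTensor fun i => m i * m' i := by
  ext p q
  simp only [piTensor, Matrix.mul_apply, Matrix.of_apply]
  rw [Finset.prod_univ_sum]
  simp [Finset.prod_mul_distrib]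

lemma piTensor_diagonal {ι J : Type*} [Fintype ι] [DecidableEq J]
    (d : ι → J → ℂ) :
    piTensor (fun i => diagonal (d i)) = diagonal fun p : ι → J => ∏ i, d i (p i) := by
  ext p q
  by_cases h : p = q
  · subst h; simp [piTensor]
  · obtain ⟨i, hi⟩ := Function.ne_iff.mp h
    rw [diagonal_apply_ne _ h]
    exact Finset.prod_eq_zero (Finset.mem_univ i) (by simp [hi])

lemma piTensor_one {ι J : Type*} [Fintype ι] [DecidableEq J] :
    piTensor (fun _ : ι => (1 : Matrix J J ℂ)) = 1 := by
  simp only [← diagonal_one]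
  rw [piTensor_diagonal]
  simp

lemma conjTranspose_piTensor {ι J : Type*} [Fintype ι] (m : ι → Matrix J J ℂ) :
    (piTensor m)ᴴ = piTensor fun i => (m i)ᴴ := by
  ext p q
  simp [piTensor]

lemma eigenvalues_le_of_posSemidef_sub {J : Type*} [Fintype J] [DecidableEq J]
    {G : Matrix J J ℂ} (hG : G.IsHermitian) {c : ℝ}
    (hc : ((c : ℂ) • (1 : Matrix J J ℂ) - G).PosSemidef) (j : J) : hG.eigenvalues j ≤ c := by
  have h := hc.re_dotProduct_nonneg (hG.eigenvectorBasis j)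
  have h1 : star ⇑(hG.eigenvectorBasis j) ⬝ᵥ ⇑(hG.eigenvectorBasis j) = (1 : ℂ) := by
    have := hG.eigenvectorBasis.orthonormal.1 j
    have h2 := inner_self_eq_norm_sq_to_K (𝕜 := ℂ) (hG.eigenvectorBasis j)
    rw [this, EuclideanSpace.inner_eq_star_dotProduct, dotProduct_comm] at h2
    simpa using h2
  rw [sub_mulVec, dotProduct_sub, smul_mulVec, one_mulVec, dotProduct_smul, h1,
    map_sub, ← hG.eigenvalues_eq] at h
  simpa using h

/-- Diagonalizing every factor diagonalizes the tensor product: its eigenvalues are products of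
eigenvalues lying in `[0, c]`. Positivity of the factors is what allows the upper bounds to be
multiplied. -/
lemma posSemidef_pow_card_smul_one_sub_piTensor {ι J : Type*} [Fintype ι] [DecidableEq ι]
    [Fintype J] [DecidableEq J] {G : ι → Matrix J J ℂ} {c : ℝ} (hG : ∀ i, (G i).PosSemidef)
    (hc : ∀ i, ((c : ℂ) • (1 : Matrix J J ℂ) - G i).PosSemidef) :
    (((c ^ Fintype.card ι : ℝ) : ℂ) • (1 : Matrix (ι → J) (ι → J) ℂ) - piTensor G).PosSemidef := by
  set U : ι → Matrix J J ℂ := fun i => (hG i).1.eigenvectorUnitary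
  set l : ι → J → ℝ := fun i => (hG i).1.eigenvalues
  have hU : ∀ i, U i * (U i)ᴴ = 1 := fun i => by
    have := (hG i).1.eigenvectorUnitary.2
    exact Matrix.mem_unitaryGroup_iff.mp this
  have hs : G = fun i => U i * diagonal (fun j => (l i j : ℂ)) * (U i)ᴴ := by
    funext i
    have := (hG i).1.spectral_theorem
    rw [Unitary.conjStarAlgAut_apply] at this
    exact this
  have hT : ((c ^ Fintype.card ι : ℝ) : ℂ) • (1 : Matrix (ι → J) (ι → J) ℂ) - piTensor G
      = piTensor U * diagonal (fun p : ι → J => ((c ^ Fintype.card ι - ∏ i, l i (p i) : ℝ) : ℂ))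
        * (piTensor U)ᴴ := by
    have h1 : diagonal (fun p : ι → J => ((c ^ Fintype.card ι - ∏ i, l i (p i) : ℝ) : ℂ))
        = ((c ^ Fintype.card ι : ℝ) : ℂ) • (1 : Matrix (ι → J) (ι → J) ℂ)
          - piTensor fun i => diagonal (fun j => (l i j : ℂ)) := by
      rw [piTensor_diagonal, ← diagonal_one, ← diagonal_smul, diagonal_sub]
      congr 1
      funext p
      simp
    rw [h1, mul_sub, sub_mul, Matrix.mul_smul, mul_one, Matrix.smul_mul, conjTranspose_piTensor,
      piTensor_mul, piTensor_mul, piTensor_mul, ← hs]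
    simp only [hU, piTensor_one]
  rw [hT]
  refine PosSemidef.mul_mul_conjTranspose_same (posSemidef_diagonal_iff.mpr fun p => ?_) _
  rw [Complex.zero_le_real, sub_nonneg]
  calc ∏ i, l i (p i) ≤ ∏ _i : ι, c :=
        Finset.prod_le_prod (fun i _ => (hG i).eigenvalues_nonneg _)
          fun i _ => eigenvalues_le_of_posSemidef_sub _ (hc i) _
    _ = c ^ Fintype.card ι := by simp

/-- The quadratic form of a tensor product of positive matrices bounded by `c`. -/
lemma re_sum_piTensor_le {ι J : Type*} [Fintype ι] [DecidableEq ι]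
    [Fintype J] [DecidableEq J] {G : ι → Matrix J J ℂ} {c : ℝ} (hG : ∀ i, (G i).PosSemidef)
    (hc : ∀ i, ((c : ℂ) • (1 : Matrix J J ℂ) - G i).PosSemidef) (v : (ι → J) → ℂ) :
    (∑ p, ∑ q, v p * star (v q) * ∏ i, G i (q i) (p i)).re
      ≤ c ^ Fintype.card ι * ∑ p, ‖v p‖ ^ 2 := by
  have h := (posSemidef_pow_card_smul_one_sub_piTensor hG hc).re_dotProduct_nonneg v
  rw [sub_mulVec, dotProduct_sub, smul_mulVec, one_mulVec, dotProduct_smul, map_sub, sub_nonneg] at h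
  convert h using 1
  · rw [Finset.sum_comm]
    simp only [dotProduct, mulVec, piTensor, Finset.mul_sum, Matrix.of_apply, Pi.star_apply]
    change Complex.re _ = Complex.re _
    congr 1
    refine Finset.sum_congr rfl fun p _ => Finset.sum_congr rfl fun q _ => ?_
    ring
  · have : star v ⬝ᵥ v = ((∑ p, ‖v p‖ ^ 2 : ℝ) : ℂ) := by
      simp only [dotProduct, Pi.star_apply, Complex.ofReal_sum]
      refine Finset.sum_congr rfl fun p _ => ?_
      rw [Complex.ofReal_pow, ← Complex.conj_mul']; rfl
    rw [this, smul_eq_mul, ← Complex.ofReal_mul]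
    exact (Complex.ofReal_re _).symm

/-! ### Second moments of multilinear forms in independent centered vectors -/

section Sampling

/-- Padding with the constant function 1 at the sample points not used turns the product into one
over all sample points, to which Fubini applies. -/
lemma prod_extend_of_injective {Ω d m : Type*} [Fintype d] [Fintype m] {t : d → m}
    (ht : Function.Injective t) (g : d → Ω → ℂ) (s : m → Ω) :
    ∏ i, Function.extend t g 1 i (s i) = ∏ a, g a (s (t a)) := by
  refine (Fintype.prod_of_injective t ht _ _ (fun i hi => ?_) fun a => ?_).symm
  · rw [Function.extend_apply' _ _ _ (by simpa using hi)]; rfl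
  · rw [ht.extend_apply]

set_option linter.unusedSectionVars false

variable {Ω : Type*} [MeasurableSpace Ω] {μ : Measure Ω} [IsProbabilityMeasure μ]

/-- Moments of a product of functions of coordinates of an independent sample. -/
lemma integral_prod_mul_prod {d d' m : Type*} [Fintype d] [Fintype d'] [Fintype m]
    {t : d → m} {t' : d' → m} (ht : Function.Injective t) (ht' : Function.Injective t')
    (g : d → Ω → ℂ) (g' : d' → Ω → ℂ) :
    ∫ s : m → Ω, (∏ a, g a (s (t a))) * ∏ a, g' a (s (t' a)) ∂(Measure.pi fun _ => μ)
      = ∏ i, ∫ ω, Function.extend t g 1 i ω * Function.extend t' g' 1 i ω ∂μ := by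
  rw [← integral_fintype_prod_eq_prod
    (fun i ω => Function.extend t g 1 i ω * Function.extend t' g' 1 i ω)]
  simp only [Finset.prod_mul_distrib, prod_extend_of_injective ht, prod_extend_of_injective ht']

lemma integral_prod_mul_prod_eq_zero {d d' m : Type*} [Fintype d] [Fintype d'] [Fintype m]
    {t : d → m} {t' : d' → m} (ht : Function.Injective t) (ht' : Function.Injective t')
    (g : d → Ω → ℂ) (g' : d' → Ω → ℂ) (b : d') (hb : ∀ a, t a ≠ t' b)
    (h0 : ∫ ω, g' b ω ∂μ = 0) :
    ∫ s : m → Ω, (∏ a, g a (s (t a))) * ∏ a, g' a (s (t' a)) ∂(Measure.pi fun _ => μ) = 0 := by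
  rw [integral_prod_mul_prod ht ht']
  refine Finset.prod_eq_zero (Finset.mem_univ (t' b)) ?_
  rw [ht'.extend_apply, Function.extend_apply' _ _ _ (by simpa using hb)]
  simpa using h0

lemma integral_prod_mul_prod_same {d m : Type*} [Fintype d] [Fintype m]
    {t : d → m} (ht : Function.Injective t) (g g' : d → Ω → ℂ) :
    ∫ s : m → Ω, (∏ a, g a (s (t a))) * ∏ a, g' a (s (t a)) ∂(Measure.pi fun _ => μ)
      = ∏ a, ∫ ω, g a ω * g' a ω ∂μ := by
  rw [integral_prod_mul_prod ht ht]
  refine (Fintype.prod_of_injective t ht _ _ (fun i hi => ?_) fun a => ?_).symm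
  · rw [Function.extend_apply' _ _ _ (by simpa using hi),
      Function.extend_apply' _ _ _ (by simpa using hi)]
    simp
  · rw [ht.extend_apply, ht.extend_apply]

/-- A random vector with bounded measurable entries of mean zero, whose covariance matrix is at
most `c`. -/
structure IsCentered {J : Type*} [Fintype J] (μ : Measure Ω) (D : Ω → J → ℂ) (c : ℝ) : Prop where
  measurable : ∀ j, Measurable fun ω => D ω j
  bounded : ∃ C, ∀ ω j, ‖D ω j‖ ≤ C
  mean : ∀ j, ∫ ω, D ω j ∂μ = 0
  variance : ∀ O : J → ℂ, ∫ ω, ‖∑ j, O j * D ω j‖ ^ 2 ∂μ ≤ c * ∑ j, ‖O j‖ ^ 2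

variable {J : Type*} [Fintype J] {D : Ω → J → ℂ} {c : ℝ}

/-- The covariance matrix. -/
def covMatrix (μ : Measure Ω) (D : Ω → J → ℂ) : Matrix J J ℂ :=
  Matrix.of fun j k => ∫ ω, D ω k * star (D ω j) ∂μ

lemma IsCentered.integrable_mul_star (h : IsCentered μ D c) (j k : J) :
    Integrable (fun ω => D ω j * star (D ω k)) μ := by
  obtain ⟨C, hC⟩ := h.bounded
  refine Integrable.of_bound ((h.measurable j).mul (continuous_star.measurable.comp (h.measurable k))).aestronglyMeasurable
    (C * C) (Filter.Eventually.of_forall fun ω => ?_)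
  rw [norm_mul, norm_star]
  exact mul_le_mul (hC ω j) (hC ω k) (norm_nonneg _) ((norm_nonneg _).trans (hC ω j))

lemma ofReal_norm_sum_sq {ι : Type*} (s : Finset ι) (f : ι → ℂ) :
    ((‖∑ i ∈ s, f i‖ ^ 2 : ℝ) : ℂ) = ∑ i ∈ s, ∑ j ∈ s, f i * star (f j) := by
  rw [Complex.ofReal_pow, ← Complex.mul_conj', map_sum, Finset.sum_mul_sum]
  rfl

/-- Translates the variance condition into the matrix inequalities `0 ≤ covMatrix ≤ c`, the form
which passes to tensor powers. -/
lemma IsCentered.quadForm (h : IsCentered μ D c) (v : J → ℂ) :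
    star v ⬝ᵥ (covMatrix μ D *ᵥ v) = ((∫ ω, ‖∑ j, v j * D ω j‖ ^ 2 ∂μ : ℝ) : ℂ) := by
  have h2 : ∀ i j, Integrable (fun ω => v i * D ω i * star (v j * D ω j)) μ := fun i j => by
    refine ((h.integrable_mul_star i j).const_mul (v i * star (v j))).congr
      (Filter.Eventually.of_forall fun ω => ?_)
    simp only [star_mul']
    ring
  rw [← integral_complex_ofReal]
  simp only [ofReal_norm_sum_sq]
  rw [integral_finsetSum _ fun i _ => integrable_finsetSum _ fun j _ => h2 i j]
  simp only [integral_finsetSum _ fun j _ => h2 _ j, dotProduct, mulVec, covMatrix, of_apply,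
    Finset.mul_sum, Pi.star_apply]
  rw [Finset.sum_comm]
  refine Finset.sum_congr rfl fun i _ => Finset.sum_congr rfl fun j _ => ?_
  rw [← integral_mul_const, ← integral_const_mul]
  congr 1
  funext ω
  simp only [star_mul']
  ring

lemma IsCentered.posSemidef_covMatrix (h : IsCentered μ D c) : (covMatrix μ D).PosSemidef := by
  refine PosSemidef.of_dotProduct_mulVec_nonneg ?_ fun v => ?_
  · ext i j
    simp only [covMatrix, conjTranspose_apply, of_apply]
    rw [← starRingEnd_apply, ← integral_conj]
    congr 1
    funext ω
    simp [mul_comm]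
  · rw [h.quadForm, Complex.zero_le_real]
    positivity

lemma IsCentered.posSemidef_sub_covMatrix [DecidableEq J] (h : IsCentered μ D c) :
    ((c : ℂ) • (1 : Matrix J J ℂ) - covMatrix μ D).PosSemidef := by
  refine PosSemidef.of_dotProduct_mulVec_nonneg ?_ fun v => ?_
  · refine IsHermitian.sub ?_ h.posSemidef_covMatrix.1
    rw [IsHermitian, conjTranspose_smul, conjTranspose_one, ← starRingEnd_apply,
      Complex.conj_ofReal]
  · have : star v ⬝ᵥ v = ((∑ p, ‖v p‖ ^ 2 : ℝ) : ℂ) := by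
      simp only [dotProduct, Pi.star_apply, Complex.ofReal_sum]
      refine Finset.sum_congr rfl fun p _ => ?_
      rw [Complex.ofReal_pow, ← Complex.conj_mul']; rfl
    rw [sub_mulVec, dotProduct_sub, smul_mulVec, one_mulVec, dotProduct_smul, h.quadForm, this,
      smul_eq_mul, ← Complex.ofReal_mul, ← Complex.ofReal_sub, Complex.zero_le_real, sub_nonneg]
    exact h.variance v

/-- A multilinear form with coefficients `H`, evaluated at the sample points `t`. -/
def multiForm {d m : Type*} [Fintype d] [DecidableEq d] (D : Ω → J → ℂ) (H : (d → J) → ℂ)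
    (t : d → m) (s : m → Ω) : ℂ :=
  ∑ p, H p * ∏ a, D (s (t a)) (p a)

variable {d m : Type*} [Fintype d] [DecidableEq d] [Fintype m]

lemma IsCentered.integrable_prod_mul_star (h : IsCentered μ D c) (t t' : d → m) (p p' : d → J) :
    Integrable (fun s : m → Ω => (∏ a, D (s (t a)) (p a)) * ∏ a, star (D (s (t' a)) (p' a)))
      (Measure.pi fun _ => μ) := by
  obtain ⟨C, hC⟩ := h.bounded
  refine Integrable.of_bound (C := (∏ _a : d, C) * ∏ _a : d, C) (Measurable.mul
    (Finset.measurable_fun_prod _ fun a _ => (h.measurable _).comp (measurable_pi_apply _))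
    (Finset.measurable_fun_prod _ fun a _ => continuous_star.measurable.comp
      ((h.measurable _).comp (measurable_pi_apply _)))).aestronglyMeasurable
    (Filter.Eventually.of_forall fun s => ?_)
  rw [norm_mul, norm_prod, norm_prod]
  simp only [norm_star]
  refine mul_le_mul ?_ ?_ (by positivity) (Finset.prod_nonneg fun a _ =>
    (norm_nonneg _).trans (hC (s (t a)) (p a))) <;>
  exact Finset.prod_le_prod (fun _ _ => norm_nonneg _) fun a _ => hC _ _

lemma multiForm_mul_star (H H' : (d → J) → ℂ) (t t' : d → m) (s : m → Ω) :
    multiForm D H t s * star (multiForm D H' t' s) = ∑ p, ∑ q, H p * star (H' q) *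
      ((∏ a, D (s (t a)) (p a)) * ∏ a, star (D (s (t' a)) (q a))) := by
  rw [multiForm, multiForm, star_sum, Finset.sum_mul_sum]
  refine Finset.sum_congr rfl fun p _ => Finset.sum_congr rfl fun q _ => ?_
  rw [star_mul', star_prod]
  ring

lemma IsCentered.integrable_multiForm (h : IsCentered μ D c) (H H' : (d → J) → ℂ) (t t' : d → m) :
    Integrable (fun s => multiForm D H t s * star (multiForm D H' t' s))
      (Measure.pi fun _ => μ) := by
  simp only [multiForm_mul_star]
  exact integrable_finsetSum _ fun p _ => integrable_finsetSum _ fun q _ =>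
    (h.integrable_prod_mul_star t t' p q).const_mul _

lemma IsCentered.integral_multiForm (h : IsCentered μ D c) (H H' : (d → J) → ℂ) (t t' : d → m) :
    ∫ s, multiForm D H t s * star (multiForm D H' t' s) ∂(Measure.pi fun _ => μ)
      = ∑ p, ∑ q, H p * star (H' q) * ∫ s : m → Ω,
        (∏ a, D (s (t a)) (p a)) * ∏ a, star (D (s (t' a)) (q a)) ∂(Measure.pi fun _ => μ) := by
  simp only [multiForm_mul_star]
  rw [integral_finsetSum _ fun p _ => integrable_finsetSum _ fun q _ =>
    (h.integrable_prod_mul_star t t' p q).const_mul _]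
  refine Finset.sum_congr rfl fun p _ => ?_
  rw [integral_finsetSum _ fun q _ => (h.integrable_prod_mul_star t t' p q).const_mul _]
  exact Finset.sum_congr rfl fun q _ => integral_const_mul _ _

/-- The sample point `t' b` occurs in a single factor of each product, so by independence the mean
of that factor, which is zero, splits off. -/
lemma IsCentered.integral_multiForm_eq_zero (h : IsCentered μ D c) (H H' : (d → J) → ℂ)
    {t t' : d → m} (ht : Function.Injective t) (ht' : Function.Injective t') (b : d)
    (hb : ∀ a, t a ≠ t' b) :
    ∫ s, multiForm D H t s * star (multiForm D H' t' s) ∂(Measure.pi fun _ => μ) = 0 := by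
  rw [h.integral_multiForm]
  refine Finset.sum_eq_zero fun p _ => Finset.sum_eq_zero fun q _ => ?_
  rw [integral_prod_mul_prod_eq_zero ht ht' (fun a ω => D ω (p a)) (fun a ω => star (D ω (q a)))
    b hb, mul_zero]
  have := integral_conj (μ := μ) (f := fun ω => D ω (q b))
  rw [h.mean, map_zero] at this
  exact this

/-- At distinct sample points the covariance of the products of entries is the `d`-fold tensor power
of `covMatrix`, and the second moment is its quadratic form at `H`. -/
lemma IsCentered.integral_norm_multiForm_sq_le (h : IsCentered μ D c) (H : (d → J) → ℂ)
    {t : d → m} (ht : Function.Injective t) :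
    ∫ s, ‖multiForm D H t s‖ ^ 2 ∂(Measure.pi fun _ => μ)
      ≤ c ^ Fintype.card d * ∑ p, ‖H p‖ ^ 2 := by
  classical
  refine le_trans (le_of_eq ?_) (re_sum_piTensor_le (fun _ : d => h.posSemidef_covMatrix)
    (fun _ => h.posSemidef_sub_covMatrix) H)
  rw [← Complex.ofReal_re (∫ s, _ ∂_), ← integral_complex_ofReal]
  congr 1
  trans ∫ s, multiForm D H t s * star (multiForm D H t s) ∂(Measure.pi fun _ : m => μ)
  · congr 1
    funext s
    rw [Complex.ofReal_pow, ← Complex.mul_conj']; rfl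
  rw [h.integral_multiForm]
  refine Finset.sum_congr rfl fun p _ => Finset.sum_congr rfl fun q _ => ?_
  rw [integral_prod_mul_prod_same ht (fun a ω => D ω (p a)) (fun a ω => star (D ω (q a)))]
  rfl

lemma IsCentered.integrable_norm_multiForm_sq (h : IsCentered μ D c) (H : (d → J) → ℂ)
    (t : d → m) :
    Integrable (fun s => ‖multiForm D H t s‖ ^ 2) (Measure.pi fun _ => μ) := by
  refine (h.integrable_multiForm H H t t).re.congr (Filter.Eventually.of_forall fun s => ?_)
  change (multiForm D H t s * (starRingEnd ℂ) (multiForm D H t s)).re = _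
  rw [Complex.mul_conj']
  norm_cast

lemma norm_sum_sq_eq {ι : Type*} (s : Finset ι) (f : ι → ℂ) :
    ‖∑ i ∈ s, f i‖ ^ 2 = ∑ i ∈ s, ∑ j ∈ s, (f i * star (f j)).re := by
  have h := congrArg Complex.re (ofReal_norm_sum_sq s f)
  rw [Complex.ofReal_re] at h
  rw [h]
  simp only [Complex.re_sum]

lemma IsCentered.integrable_norm_sum_multiForm_sq (h : IsCentered μ D c) (H : (d → J) → ℂ)
    (I : Finset (d → m)) :
    Integrable (fun s => ‖∑ t ∈ I, multiForm D H t s‖ ^ 2) (Measure.pi fun _ => μ) := by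
  simp only [norm_sum_sq_eq]
  exact integrable_finsetSum _ fun t _ => integrable_finsetSum _ fun t' _ =>
    (h.integrable_multiForm H H t t').re

lemma re_mul_star_le (z w : ℂ) : (z * star w).re ≤ (‖z‖ ^ 2 + ‖w‖ ^ 2) / 2 := by
  have h1 := Complex.re_le_norm (z * star w)
  rw [norm_mul, norm_star] at h1
  nlinarith [sq_nonneg (‖z‖ - ‖w‖)]

/-- Second moment of a sum of multilinear forms over injective choices of sample points. -/
lemma IsCentered.integral_norm_sum_multiForm_sq_le (h : IsCentered μ D c) (hc : 0 ≤ c)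
    (H : (d → J) → ℂ) (I : Finset (d → m)) (hI : ∀ t ∈ I, Function.Injective t) :
    ∫ s, ‖∑ t ∈ I, multiForm D H t s‖ ^ 2 ∂(Measure.pi fun _ => μ)
      ≤ I.card * (Fintype.card d ^ Fintype.card d : ℕ) *
        (c ^ Fintype.card d * ∑ p, ‖H p‖ ^ 2) := by
  classical
  set B := c ^ Fintype.card d * ∑ p, ‖H p‖ ^ 2
  have hB : 0 ≤ B := by positivity
  -- Two tuples correlate only if every entry of `t'` occurs in `t`, that is, `t' = t ∘ g` for some
  -- `g : d → d`. There are at most `d ^ d` such `t'`, a crude replacement for `d!`, and each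
  -- correlation is at most `B` by the arithmetic-geometric mean inequality.
  have hcov : ∀ t ∈ I, ∀ t' ∈ I,
      ∫ s, (multiForm D H t s * star (multiForm D H t' s)).re ∂(Measure.pi fun _ => μ)
        ≤ if t' ∈ Finset.univ.image (fun g : d → d => t ∘ g) then B else 0 := by
    intro t ht t' ht'
    split_ifs with hm
    · calc _ ≤ ∫ s, (‖multiForm D H t s‖ ^ 2 + ‖multiForm D H t' s‖ ^ 2) / 2
            ∂(Measure.pi fun _ => μ) :=
          integral_mono (h.integrable_multiForm H H t t').re
            (((h.integrable_norm_multiForm_sq H t).add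
              (h.integrable_norm_multiForm_sq H t')).div_const 2) fun s => re_mul_star_le _ _
        _ = (∫ s, ‖multiForm D H t s‖ ^ 2 ∂(Measure.pi fun _ => μ)
            + ∫ s, ‖multiForm D H t' s‖ ^ 2 ∂(Measure.pi fun _ => μ)) / 2 := by
          rw [integral_div, integral_add (h.integrable_norm_multiForm_sq H t)
            (h.integrable_norm_multiForm_sq H t')]
        _ ≤ B := by
          linarith [h.integral_norm_multiForm_sq_le H (hI t ht),
            h.integral_norm_multiForm_sq_le H (hI t' ht')]
    · obtain ⟨b, hb⟩ : ∃ b, ∀ a, t a ≠ t' b := by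
        by_contra! hcon
        choose g hg using hcon
        exact hm (Finset.mem_image.mpr ⟨g, Finset.mem_univ _, funext hg⟩)
      have h0 := h.integral_multiForm_eq_zero H H (hI t ht) (hI t' ht') b hb
      have h1 := integral_re (h.integrable_multiForm H H t t')
      rw [h0] at h1
      exact h1.le.trans (by simp)
  simp only [norm_sum_sq_eq]
  have hint : ∀ t t' : d → m, Integrable
      (fun s => (multiForm D H t s * star (multiForm D H t' s)).re) (Measure.pi fun _ => μ) :=
    fun t t' => (h.integrable_multiForm H H t t').re
  rw [integral_finsetSum _ fun t _ => integrable_finsetSum _ fun t' _ => hint t t']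
  simp only [integral_finsetSum _ fun t' _ => hint _ t']
  calc _ ≤ ∑ t ∈ I, ((Fintype.card d ^ Fintype.card d : ℕ) : ℝ) * B := by
        refine Finset.sum_le_sum fun t ht => (Finset.sum_le_sum fun t' ht' =>
          hcov t ht t' ht').trans ?_
        rw [← Finset.sum_filter, Finset.sum_const, nsmul_eq_mul]
        refine mul_le_mul_of_nonneg_right (Nat.cast_le.mpr ?_) hB
        refine (Finset.card_le_card (t := Finset.univ.image fun g : d → d => t ∘ g)
          fun x hx => (Finset.mem_filter.mp hx).2).trans (Finset.card_image_le.trans ?_)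
        simp
    _ = _ := by rw [Finset.sum_const, nsmul_eq_mul, mul_assoc]

end Sampling

/-! ### Averages over tuples of distinct indices -/

/-- Injective choices of `d` among `m` sample points. -/
def injTuples (d M : ℕ) : Finset (Fin d → Fin M) := by
  classical exact Finset.univ.filter Function.Injective

lemma mem_injTuples {d M : ℕ} {t : Fin d → Fin M} : t ∈ injTuples d M ↔ Function.Injective t := by
  simp [injTuples]

lemma card_injTuples (d M : ℕ) : (injTuples d M).card = M.descFactorial d := by
  classical
  have h := Fintype.card_embedding_eq (α := Fin d) (β := Fin M)
  simp only [Fintype.card_fin] at h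
  rw [← h, injTuples, ← Fintype.card_subtype]
  exact Fintype.card_congr (Equiv.subtypeInjectiveEquivEmbedding _ _)

lemma exists_perm_comp_eq {d M : ℕ} {r r' : Fin d → Fin M} (hr : Function.Injective r)
    (hr' : Function.Injective r') : ∃ σ : Equiv.Perm (Fin M), σ ∘ r = r' := by
  classical
  let e : {x // x ∈ Set.range r} ≃ {x // x ∈ Set.range r'} :=
    (Equiv.ofInjective r hr).symm.trans (Equiv.ofInjective r' hr')
  refine ⟨e.extendSubtype, funext fun a => ?_⟩
  rw [Function.comp_apply, Equiv.extendSubtype_apply_of_mem e _ ⟨a, rfl⟩]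
  simp only [e, Equiv.trans_apply]
  have : (Equiv.ofInjective r hr).symm ⟨r a, ⟨a, rfl⟩⟩ = a := Equiv.ofInjective_symm_apply hr a
  rw [this]; rfl

/-- Averages over injective tuples only depend on the entries which are used. -/
lemma card_mul_sum_injTuples_comp {d e M : ℕ} {f : Fin d → Fin e} (hf : Function.Injective f)
    (g : (Fin d → Fin M) → ℂ) :
    ((injTuples d M).card : ℂ) * ∑ t ∈ injTuples e M, g (t ∘ f)
      = ((injTuples e M).card : ℂ) * ∑ r ∈ injTuples d M, g r := by
  classical
  have hmap : ∀ t ∈ injTuples e M, t ∘ f ∈ injTuples d M := fun t ht =>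
    mem_injTuples.mpr ((mem_injTuples.mp ht).comp hf)
  -- All fibres of `t ↦ t ∘ f` have the same size, because the permutations of the sample points act
  -- transitively on injective tuples.
  have hN : ∀ r ∈ injTuples d M, ∀ r' ∈ injTuples d M,
      ((injTuples e M).filter fun t => t ∘ f = r).card
        = ((injTuples e M).filter fun t => t ∘ f = r').card := by
    intro r hr r' hr'
    obtain ⟨σ, rfl⟩ := exists_perm_comp_eq (mem_injTuples.mp hr) (mem_injTuples.mp hr')
    refine Finset.card_bij (fun t _ => σ ∘ t) (fun t ht => ?_) (fun t _ t' _ h => ?_)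
      fun t ht => ⟨σ.symm ∘ t, ?_, ?_⟩
    · obtain ⟨h1, h2⟩ := Finset.mem_filter.mp ht
      exact Finset.mem_filter.mpr ⟨mem_injTuples.mpr (σ.injective.comp (mem_injTuples.mp h1)),
        by rw [← h2]; rfl⟩
    · exact σ.injective.comp_left h
    · obtain ⟨h1, h2⟩ := Finset.mem_filter.mp ht
      refine Finset.mem_filter.mpr
        ⟨mem_injTuples.mpr (σ.symm.injective.comp (mem_injTuples.mp h1)), ?_⟩
      rw [Function.comp_assoc, h2]
      funext a; simp
    · funext a; simp
  rcases (injTuples d M).eq_empty_or_nonempty with h0 | ⟨r₀, hr₀⟩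
  · have : injTuples e M = ∅ := Finset.eq_empty_of_forall_notMem fun t ht => by
      have := hmap t ht
      simp [h0] at this
    simp [h0, this]
  · have hsum : ∀ φ : (Fin d → Fin M) → ℂ, ∑ t ∈ injTuples e M, φ (t ∘ f)
        = (((injTuples e M).filter fun t => t ∘ f = r₀).card : ℂ) * ∑ r ∈ injTuples d M, φ r := by
      intro φ
      rw [← Finset.sum_fiberwise_of_maps_to hmap, Finset.mul_sum]
      refine Finset.sum_congr rfl fun r hr => ?_
      rw [Finset.sum_congr rfl fun t ht => by rw [(Finset.mem_filter.mp ht).2], Finset.sum_const,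
        hN r hr r₀ hr₀, nsmul_eq_mul]
    have h1 := hsum fun _ => 1
    simp only [Finset.sum_const, nsmul_eq_mul, mul_one] at h1
    rw [hsum, h1]
    ring

lemma sum_perm_fin_three {α : Type*} [AddCommMonoid α] (F : Equiv.Perm (Fin 3) → α) :
    ∑ π, F π = F 1 + F (Equiv.swap 0 1) + F (Equiv.swap 0 2) + F (Equiv.swap 1 2)
      + F (Equiv.swap 0 1 * Equiv.swap 1 2) + F (Equiv.swap 1 2 * Equiv.swap 0 1) := by
  have h : (Finset.univ : Finset (Equiv.Perm (Fin 3))) = {1, Equiv.swap 0 1, Equiv.swap 0 2,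
    Equiv.swap 1 2, Equiv.swap 0 1 * Equiv.swap 1 2, Equiv.swap 1 2 * Equiv.swap 0 1} := by decide
  rw [h]
  repeat rw [Finset.sum_insert (by decide)]
  rw [Finset.sum_singleton]
  simp only [add_assoc]

/-- A triple of distinct indices has exactly one increasing rearrangement; a triple with a
repetition has none. -/
lemma sum_perm_indicator_increasing {M : ℕ} (t : Fin 3 → Fin M) :
    (∑ π : Equiv.Perm (Fin 3),
      if t (π 0) < t (π 1) ∧ t (π 1) < t (π 2) then (1 : ℂ) else 0)
      = if t ∈ injTuples 3 M then 1 else 0 := by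
  have hinj : t ∈ injTuples 3 M ↔ t 0 ≠ t 1 ∧ t 0 ≠ t 2 ∧ t 1 ≠ t 2 := by
    rw [mem_injTuples]
    constructor
    · intro h
      refine ⟨h.ne (by decide), h.ne (by decide), h.ne (by decide)⟩
    · rintro ⟨h1, h2, h3⟩ a b hab
      fin_cases a <;> fin_cases b <;> simp_all
  rw [sum_perm_fin_three]
  have e1 : (Equiv.swap 0 1 * Equiv.swap 1 2 : Equiv.Perm (Fin 3)) 0 = 1 := by decide
  have e2 : (Equiv.swap 0 1 * Equiv.swap 1 2 : Equiv.Perm (Fin 3)) 1 = 2 := by decide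
  have e3 : (Equiv.swap 0 1 * Equiv.swap 1 2 : Equiv.Perm (Fin 3)) 2 = 0 := by decide
  have e4 : (Equiv.swap 1 2 * Equiv.swap 0 1 : Equiv.Perm (Fin 3)) 0 = 2 := by decide
  have e5 : (Equiv.swap 1 2 * Equiv.swap 0 1 : Equiv.Perm (Fin 3)) 1 = 0 := by decide
  have e6 : (Equiv.swap 1 2 * Equiv.swap 0 1 : Equiv.Perm (Fin 3)) 2 = 1 := by decide
  have e7 : (Equiv.swap 0 1 : Equiv.Perm (Fin 3)) 2 = 2 := by decide
  have e8 : (Equiv.swap 0 2 : Equiv.Perm (Fin 3)) 1 = 1 := by decide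
  have e9 : (Equiv.swap 1 2 : Equiv.Perm (Fin 3)) 0 = 0 := by decide
  simp only [hinj, e1, e2, e3, e4, e5, e6, e7, e8, e9, Equiv.swap_apply_left,
    Equiv.swap_apply_right, Equiv.Perm.one_apply]
  rcases lt_trichotomy (t 0) (t 1) with h1 | h1 | h1 <;>
  rcases lt_trichotomy (t 0) (t 2) with h2 | h2 | h2 <;>
  rcases lt_trichotomy (t 1) (t 2) with h3 | h3 | h3 <;>
  first
  | (exfalso; omega)
  | simp [h1, h2, h3, h1.ne, h2.ne, h3.ne, h1.ne', h2.ne', h3.ne',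
      h1.not_gt, h2.not_gt, h3.not_gt]
  | (simp [h1, h2, h3]; done)
  | (simp [h1, h2, h3]; omega)

lemma sum_increasing_sum_perm {M : ℕ} (F : (Fin 3 → Fin M) → ℂ) :
    ∑ t : Fin 3 → Fin M with t 0 < t 1 ∧ t 1 < t 2, ∑ π : Equiv.Perm (Fin 3), F (t ∘ π)
      = ∑ t ∈ injTuples 3 M, F t := by
  have h1 : ∀ π : Equiv.Perm (Fin 3),
      ∑ t : Fin 3 → Fin M, (if t 0 < t 1 ∧ t 1 < t 2 then (1 : ℂ) else 0) * F (t ∘ π)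
        = ∑ t : Fin 3 → Fin M, (if t (π⁻¹ 0) < t (π⁻¹ 1) ∧ t (π⁻¹ 1) < t (π⁻¹ 2)
          then (1 : ℂ) else 0) * F t := by
    intro π
    refine Fintype.sum_equiv (Equiv.arrowCongr π⁻¹ (Equiv.refl _)) _ _ fun t => ?_
    have h2 : Equiv.arrowCongr π⁻¹ (Equiv.refl _) t = t ∘ π := rfl
    have h3 : ∀ x, π (π⁻¹ x) = x := π.apply_symm_apply
    simp only [h2, Function.comp_apply, h3]
  calc _ = ∑ π : Equiv.Perm (Fin 3), ∑ t : Fin 3 → Fin M,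
        (if t 0 < t 1 ∧ t 1 < t 2 then (1 : ℂ) else 0) * F (t ∘ π) := by
        rw [Finset.sum_filter, Finset.sum_comm]
        refine Finset.sum_congr rfl fun t _ => ?_
        rw [← Finset.mul_sum]
        split_ifs <;> simp
    _ = ∑ t : Fin 3 → Fin M, (∑ π : Equiv.Perm (Fin 3),
        if t (π 0) < t (π 1) ∧ t (π 1) < t (π 2) then (1 : ℂ) else 0) * F t := by
        simp only [h1]
        rw [Finset.sum_comm]
        refine Finset.sum_congr rfl fun t _ => ?_
        rw [Finset.sum_mul]
        exact Equiv.sum_comp (Equiv.inv (Equiv.Perm (Fin 3))) fun π =>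
          (if t (π 0) < t (π 1) ∧ t (π 1) < t (π 2) then (1 : ℂ) else 0) * F t
    _ = _ := by
        simp only [sum_perm_indicator_increasing, ite_mul, one_mul, zero_mul]
        rw [Finset.sum_ite_mem, Finset.univ_inter]

/-- The cubic U-statistic is the average of `Tr (X_i X_j X_k)` over distinct `i`, `j`, `k`. -/
lemma cubicUStat_eq_average {κ : Type} [Fintype κ] {M : ℕ} (X : Fin M → Matrix κ κ ℂ) :
    cubicUStat X = ((injTuples 3 M).card : ℂ)⁻¹ *
      ∑ t ∈ injTuples 3 M, (X (t 0) * X (t 1) * X (t 2)).trace := by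
  rw [← sum_increasing_sum_perm fun t => (X (t 0) * X (t 1) * X (t 2)).trace, cubicUStat,
    card_injTuples, Nat.descFactorial_eq_factorial_mul_choose]
  simp only [trace_smul, trace_sum, smul_eq_mul, ← Finset.mul_sum, Function.comp_apply]
  rw [← mul_assoc]
  congr 1
  rw [Nat.cast_mul, mul_inv, mul_comm]
  norm_num [Nat.factorial]

/-! ### Moments of a row of a random unitary -/

instance instIsProbabilityMeasureHaarU2 : IsProbabilityMeasure haarU2 :=
  ⟨Measure.haarMeasure_self⟩

instance instIsHaarMeasureHaarU2 : haarU2.IsHaarMeasure := by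
  unfold haarU2; infer_instance

lemma integral_haarU2_mul_right (f : U2 → ℂ) (V : U2) :
    ∫ U, f (U * V) ∂haarU2 = ∫ U, f U ∂haarU2 := by
  have hm : Measurable fun U : U2 => U * V := measurable_mul_const V
  have : IsProbabilityMeasure (haarU2.map (· * V)) := Measure.isProbabilityMeasure_map hm.aemeasurable
  -- A right translate of a left Haar measure is again left invariant, so uniqueness of the Haar
  -- probability measure gives right invariance.
  have h : haarU2.map (· * V) = haarU2 := Measure.isHaarMeasure_eq_of_isProbabilityMeasure _ _
  conv_rhs => rw [← h]
  exact ((Homeomorph.mulRight V).measurableEmbedding.integral_map _).symm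

lemma continuous_entry (i j : Fin 2) : Continuous fun U : U2 => U.1 i j :=
  (continuous_apply_apply i j).comp continuous_subtype_val

lemma norm_entry_le (U : U2) (i j : Fin 2) : ‖U.1 i j‖ ≤ 1 := entry_norm_bound_of_unitary U.2 i j

/-- The entries `U_{ka} conj U_{kb}` of the rank-one projection on the `k`-th row of `U`. -/
def rowProj (k : Fin 2) (U : U2) (a b : Fin 2) : ℂ := U.1 k a * star (U.1 k b)

lemma measurable_rowProj (k a b : Fin 2) : Measurable fun U => rowProj k U a b :=
  ((continuous_entry k a).mul (continuous_entry k b).star).measurable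

lemma norm_rowProj_le (k : Fin 2) (U : U2) (a b : Fin 2) : ‖rowProj k U a b‖ ≤ 1 := by
  rw [rowProj, norm_mul, norm_star]
  exact mul_le_one₀ (norm_entry_le _ _ _) (norm_nonneg _) (norm_entry_le _ _ _)

lemma star_rowProj (k : Fin 2) (U : U2) (a b : Fin 2) :
    star (rowProj k U a b) = rowProj k U b a := by
  simp [rowProj, mul_comm]

lemma sum_rowProj_diag (k : Fin 2) (U : U2) : rowProj k U 0 0 + rowProj k U 1 1 = 1 := by
  have h := congrFun (congrFun (Matrix.mem_unitaryGroup_iff.mp U.2) k) k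
  simpa [Matrix.mul_apply, Fin.sum_univ_two, rowProj] using h

lemma sum_rowProj (U : U2) (a b : Fin 2) :
    rowProj 0 U a b + rowProj 1 U a b = if a = b then 1 else 0 := by
  have h := congrFun (congrFun (Matrix.mem_unitaryGroup_iff'.mp U.2) b) a
  simp only [Matrix.mul_apply, Fin.sum_univ_two, star_apply, Matrix.one_apply] at h
  rw [rowProj, rowProj, mul_comm, mul_comm (U.1 1 a), h]
  simp [eq_comm]

lemma integrable_rowProj_mul (ν : Measure U2) [IsProbabilityMeasure ν] (k a b c d : Fin 2) :
    Integrable (fun U => rowProj k U a b * rowProj k U c d) ν := by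
  refine Integrable.of_bound (C := 1)
    ((measurable_rowProj k a b).mul (measurable_rowProj k c d)).aestronglyMeasurable
    (Filter.Eventually.of_forall fun U => ?_)
  rw [norm_mul]
  exact mul_le_one₀ (norm_rowProj_le _ _ _ _) (norm_nonneg _) (norm_rowProj_le _ _ _ _)

/-- The second moments of the projection on a row. -/
def rowMoment (ν : Measure U2) (k a b c d : Fin 2) : ℂ :=
  ∫ U, rowProj k U a b * rowProj k U c d ∂ν

lemma rowProj_mul_right (k : Fin 2) (U V : U2) (a b : Fin 2) :
    rowProj k (U * V) a b = ∑ i, ∑ j, V.1 i a * star (V.1 j b) * rowProj k U i j := by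
  have h : (U * V).1 = U.1 * V.1 := rfl
  simp only [rowProj, h, Matrix.mul_apply, Fin.sum_univ_two, star_add, star_mul']
  ring

/-- Diagonal phase gate. -/
def phaseGate : U2 := ⟨!![1, 0; 0, Complex.I], by
  rw [Matrix.mem_unitaryGroup_iff]
  ext i j
  fin_cases i <;> fin_cases j <;> simp [Matrix.mul_apply, Fin.sum_univ_two, star_apply]⟩

/-- The bit flip. -/
def flipGate : U2 := ⟨!![0, 1; 1, 0], by
  rw [Matrix.mem_unitaryGroup_iff]
  ext i j
  fin_cases i <;> fin_cases j <;> simp [Matrix.mul_apply, Fin.sum_univ_two, star_apply]⟩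

/-- A real rotation by `π / 4`. -/
def rotGate : U2 := ⟨!![((Real.sqrt 2)⁻¹ : ℂ), -((Real.sqrt 2)⁻¹ : ℂ);
    ((Real.sqrt 2)⁻¹ : ℂ), ((Real.sqrt 2)⁻¹ : ℂ)], by
  have h : ((Real.sqrt 2 : ℝ) : ℂ)⁻¹ * ((Real.sqrt 2 : ℝ) : ℂ)⁻¹ = 1 / 2 := by
    rw [← mul_inv, ← Complex.ofReal_mul, Real.mul_self_sqrt (by norm_num)]
    norm_num
  rw [Matrix.mem_unitaryGroup_iff]
  ext i j
  fin_cases i <;> fin_cases j <;>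
    simp [Matrix.mul_apply, Fin.sum_univ_two, star_apply, h] <;> norm_num⟩

/-- Each fixed unitary `V` gives linear equations between the Haar moments. Three choices of `V`
together with normalization determine them. -/
lemma rowMoment_haarU2_mul_right (V : U2) (k a b c d : Fin 2) :
    rowMoment haarU2 k a b c d = ∑ i, ∑ j, ∑ i', ∑ j', V.1 i a * star (V.1 j b) *
      (V.1 i' c * star (V.1 j' d)) * rowMoment haarU2 k i j i' j' := by
  rw [rowMoment, ← integral_haarU2_mul_right _ V]
  have h : ∀ U, rowProj k (U * V) a b * rowProj k (U * V) c d
      = ∑ i, ∑ j, ∑ i', ∑ j', V.1 i a * star (V.1 j b) *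
      (V.1 i' c * star (V.1 j' d)) * (rowProj k U i j * rowProj k U i' j') := by
    intro U
    rw [rowProj_mul_right, rowProj_mul_right]
    simp only [Fin.sum_univ_two]
    ring
  have hi : ∀ i j i' j', Integrable (fun U => V.1 i a * star (V.1 j b) *
      (V.1 i' c * star (V.1 j' d)) * (rowProj k U i j * rowProj k U i' j')) haarU2 :=
    fun i j i' j' => (integrable_rowProj_mul _ k i j i' j').const_mul _
  simp only [h]
  rw [integral_finsetSum _ fun i _ => integrable_finsetSum _ fun j _ => integrable_finsetSum _
    fun i' _ => integrable_finsetSum _ fun j' _ => hi i j i' j']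
  refine Finset.sum_congr rfl fun i _ => ?_
  rw [integral_finsetSum _ fun j _ => integrable_finsetSum _
    fun i' _ => integrable_finsetSum _ fun j' _ => hi i j i' j']
  refine Finset.sum_congr rfl fun j _ => ?_
  rw [integral_finsetSum _ fun i' _ => integrable_finsetSum _ fun j' _ => hi i j i' j']
  refine Finset.sum_congr rfl fun i' _ => ?_
  rw [integral_finsetSum _ fun j' _ => hi i j i' j']
  exact Finset.sum_congr rfl fun j' _ => integral_const_mul _ _

lemma rowMoment_comm (ν : Measure U2) (k a b c d : Fin 2) :
    rowMoment ν k a b c d = rowMoment ν k c d a b := by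
  simp only [rowMoment, mul_comm]

lemma rowMoment_swap (ν : Measure U2) (k a b c d : Fin 2) :
    rowMoment ν k a b c d = rowMoment ν k a d c b := by
  simp only [rowMoment, rowProj]
  congr 1; funext U; ring

lemma sum_rowMoment_diag (ν : Measure U2) [IsProbabilityMeasure ν] (k : Fin 2) :
    rowMoment ν k 0 0 0 0 + rowMoment ν k 0 0 1 1 + rowMoment ν k 1 1 0 0
      + rowMoment ν k 1 1 1 1 = 1 := by
  simp only [rowMoment]
  rw [← integral_add, ← integral_add, ← integral_add]
  · have : ∀ U, rowProj k U 0 0 * rowProj k U 0 0 + rowProj k U 0 0 * rowProj k U 1 1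
        + rowProj k U 1 1 * rowProj k U 0 0 + rowProj k U 1 1 * rowProj k U 1 1 = 1 := fun U => by
      linear_combination (rowProj k U 0 0 + rowProj k U 1 1 + 1) * sum_rowProj_diag k U
    simp [this]
  all_goals first
    | exact integrable_rowProj_mul _ _ _ _ _ _
    | exact (integrable_rowProj_mul _ _ _ _ _ _).add (integrable_rowProj_mul _ _ _ _ _ _)
    | exact ((integrable_rowProj_mul _ _ _ _ _ _).add (integrable_rowProj_mul _ _ _ _ _ _)).add
        (integrable_rowProj_mul _ _ _ _ _ _)

lemma rowMoment_haarU2 (k a b c d : Fin 2) :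
    rowMoment haarU2 k a b c d
      = ((if a = b then 1 else 0) * (if c = d then 1 else 0)
        + (if a = d then 1 else 0) * (if c = b then 1 else 0)) / 6 := by
  have hph := rowMoment_haarU2_mul_right phaseGate k
  have hfl := rowMoment_haarU2_mul_right flipGate k
  have hro := rowMoment_haarU2_mul_right rotGate k 0 0 0 0
  have hsum := sum_rowMoment_diag haarU2 k
  have hs := rowMoment_swap haarU2 k
  have hc := rowMoment_comm haarU2 k
  -- The phase gate multiplies the moment by `I ^ (a + c - b - d)`. The exponent is between -2 and
  -- 2, so this factor differs from 1 unless the exponent is zero.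
  have hdiff : ∀ a b c d : Fin 2, (a : ℕ) + c ≠ b + d → rowMoment haarU2 k a b c d = 0 := by
    intro a b c d hne
    have h := hph a b c d
    clear hph hfl hro hsum hs hc
    fin_cases a <;> fin_cases b <;> fin_cases c <;> fin_cases d <;> simp at hne <;>
      simp [phaseGate, Fin.sum_univ_two] at h ⊢
    all_goals
      generalize rowMoment _ _ _ _ _ _ = m at h ⊢
      first
      | linear_combination h / 2
      | linear_combination (1 + Complex.I) / 2 * h + m / 2 * Complex.I_sq
      | linear_combination (1 - Complex.I) / 2 * h + m / 2 * Complex.I_sq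
  have hf0 : rowMoment haarU2 k 0 0 0 0 = rowMoment haarU2 k 1 1 1 1 := by
    simpa [flipGate, Fin.sum_univ_two] using hfl 0 0 0 0
  -- Of the sixteen terms produced by the rotation only six survive `hdiff`, each with weight 1/4.
  have hr : rowMoment haarU2 k 0 0 0 0 = 2 * rowMoment haarU2 k 0 0 1 1 := by
    have h : ((Real.sqrt 2 : ℝ) : ℂ)⁻¹ * ((Real.sqrt 2 : ℝ) : ℂ)⁻¹ = 1 / 2 := by
      rw [← mul_inv, ← Complex.ofReal_mul, Real.mul_self_sqrt (by norm_num)]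
      norm_num
    simp [rotGate, Fin.sum_univ_two, hdiff, h] at hro
    rw [hs 0 1 1 0, hs 1 0 0 1, hc 1 1 0 0, ← hf0] at hro
    linear_combination 2 * hro
  rw [hc 1 1 0 0, ← hf0, hr] at hsum
  have h1 : rowMoment haarU2 k 0 0 1 1 = 1 / 6 := by linear_combination hsum / 6
  have h0 : rowMoment haarU2 k 0 0 0 0 = 1 / 3 := by rw [hr, h1]; norm_num
  have h2 : rowMoment haarU2 k 1 1 1 1 = 1 / 3 := by rw [← hf0, h0]
  have h3 : rowMoment haarU2 k 1 1 0 0 = 1 / 6 := by rw [hc, h1]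
  have h4 : rowMoment haarU2 k 0 1 1 0 = 1 / 6 := by rw [hs, h1]
  have h5 : rowMoment haarU2 k 1 0 0 1 = 1 / 6 := by rw [hs, h3]
  clear hph hfl hro hsum hs hc hf0 hr
  fin_cases a <;> fin_cases b <;> fin_cases c <;> fin_cases d <;>
    first
    | (simp [hdiff]; done)
    | (simp [h0, h1, h2, h3, h4, h5]; done)
    | (simp [h0, h2]; norm_num)

/-- Rows of a unitary have norm one, so a third factor summed over its diagonal entries can be
inserted for free. Second moments are thus contractions of the third moments fixed by the design
condition. -/
lemma rowMoment_eq_sum (ν : Measure U2) [IsProbabilityMeasure ν] (k a b c d : Fin 2) :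
    rowMoment ν k a b c d = ∑ e : Fin 2, ∫ U : U2, ∏ t : Fin 3,
      (U.1 k (![a, c, e] t) * star (U.1 k (![b, d, e] t))) ∂ν := by
  have h : ∀ (e : Fin 2) (U : U2), ∏ t : Fin 3, (U.1 k (![a, c, e] t) * star (U.1 k (![b, d, e] t)))
      = rowProj k U a b * rowProj k U c d * rowProj k U e e := fun e U => by
    simp [Fin.prod_univ_three, rowProj]
  simp only [h]
  rw [Fin.sum_univ_two, ← integral_add, rowMoment]
  · congr 1; funext U
    rw [← mul_add, sum_rowProj_diag, mul_one]
  all_goals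
    refine (integrable_rowProj_mul ν k a b c d).mul_bdd (c := 1)
      (measurable_rowProj k _ _).aestronglyMeasurable
      (Filter.Eventually.of_forall fun U => norm_rowProj_le _ _ _ _)

/-- The second moments of the rows of a unitary 3-design. -/
lemma IsUnitaryThreeDesign.rowMoment_eq {ν : Measure U2} (hν : IsUnitaryThreeDesign ν)
    (k a b c d : Fin 2) :
    rowMoment ν k a b c d
      = ((if a = b then 1 else 0) * (if c = d then 1 else 0)
        + (if a = d then 1 else 0) * (if c = b then 1 else 0)) / 6 := by
  have := hν.1
  rw [← rowMoment_haarU2 k, rowMoment_eq_sum, rowMoment_eq_sum]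
  exact Finset.sum_congr rfl fun e _ => hν.2 (fun _ => k) ![a, c, e] (fun _ => k) ![b, d, e]

lemma integrable_rowProj (ν : Measure U2) [IsProbabilityMeasure ν] (k a b : Fin 2) :
    Integrable (fun U => rowProj k U a b) ν :=
  Integrable.of_bound (measurable_rowProj k a b).aestronglyMeasurable 1
    (Filter.Eventually.of_forall fun _ => norm_rowProj_le _ _ _ _)

lemma IsUnitaryThreeDesign.integral_rowProj {ν : Measure U2} (hν : IsUnitaryThreeDesign ν)
    (k a b : Fin 2) : ∫ U, rowProj k U a b ∂ν = (if a = b then 1 else 0) / 2 := by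
  have := hν.1
  have h : ∫ U, rowProj k U a b ∂ν = rowMoment ν k a b 0 0 + rowMoment ν k a b 1 1 := by
    rw [rowMoment, rowMoment, ← integral_add (integrable_rowProj_mul ν k a b 0 0)
      (integrable_rowProj_mul ν k a b 1 1)]
    congr 1; funext U
    rw [← mul_add, sum_rowProj_diag, mul_one]
  rw [h, hν.rowMoment_eq, hν.rowMoment_eq]
  fin_cases a <;> fin_cases b <;> norm_num

/-! ### Mean and second moments of a single-qubit snapshot -/

/-- An entry of the single-qubit snapshot. -/
def snapEntry (k : Fin 2) (U : U2) (x y : Fin 2) : ℂ :=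
  3 * rowProj k U y x - if x = y then 1 else 0

lemma measurable_snapEntry (k x y : Fin 2) : Measurable fun U => snapEntry k U x y :=
  ((measurable_rowProj k y x).const_mul 3).sub_const _

lemma norm_snapEntry_le (k : Fin 2) (U : U2) (x y : Fin 2) : ‖snapEntry k U x y‖ ≤ 4 := by
  refine (norm_sub_le _ _).trans ?_
  rw [norm_mul]
  have h1 := norm_rowProj_le k U y x
  have h2 : ‖(if x = y then 1 else 0 : ℂ)‖ ≤ 1 := by split_ifs <;> simp
  have h3 : ‖(3 : ℂ)‖ = 3 := by simp
  rw [h3]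
  linarith

lemma snapEntry_eq (k : Fin 2) (U : U2) (x y : Fin 2) :
    ((3 : ℂ) • (U.1ᴴ * Matrix.single k k 1 * U.1) - 1 : Matrix (Fin 2) (Fin 2) ℂ) x y = snapEntry k U x y := by
  rw [Matrix.sub_apply, Matrix.smul_apply, snapEntry, rowProj, Matrix.one_apply, smul_eq_mul]
  congr 2
  fin_cases k <;> simp [Matrix.mul_apply, Fin.sum_univ_two, Matrix.single_apply, mul_comm]

lemma IsUnitaryThreeDesign.sum_integral_rowProj {ν : Measure U2} (hν : IsUnitaryThreeDesign ν)
    (a b : Fin 2) : ∑ k, ∫ U, rowProj k U a b ∂ν = if a = b then 1 else 0 := by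
  simp only [hν.integral_rowProj, Fin.sum_univ_two]
  ring

/-- The single-qubit snapshot is unbiased. -/
lemma IsUnitaryThreeDesign.sum_integral_rowProj_mul_snapEntry {ν : Measure U2}
    (hν : IsUnitaryThreeDesign ν) (a b x y : Fin 2) :
    ∑ k, ∫ U, rowProj k U a b * snapEntry k U x y ∂ν
      = (if a = x then 1 else 0) * (if b = y then 1 else 0) := by
  have := hν.1
  have h : ∀ k, ∫ U, rowProj k U a b * snapEntry k U x y ∂ν
      = 3 * rowMoment ν k a b y x - (if x = y then 1 else 0) * ∫ U, rowProj k U a b ∂ν := by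
    intro k
    rw [rowMoment, ← integral_const_mul, ← integral_const_mul, ← integral_sub]
    · congr 1; funext U; rw [snapEntry]; ring
    · exact (integrable_rowProj_mul ν k a b y x).const_mul _
    · exact (integrable_rowProj ν k a b).const_mul _
  simp only [h, hν.rowMoment_eq, hν.integral_rowProj, Fin.sum_univ_two]
  fin_cases a <;> fin_cases b <;> fin_cases x <;> fin_cases y <;> norm_num

/-- The indices of the second moments of a snapshot. -/
abbrev KernelIndex : Type := Fin 2 × Fin 2 × Fin 2

/-- The second moments of a single-qubit snapshot, as a matrix. -/
def secondMoment (ν : Measure U2) : Matrix KernelIndex KernelIndex ℂ :=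
  Matrix.of fun q p => ∑ k, ∫ U, rowProj k U p.1 q.1 *
    (snapEntry k U p.2.1 p.2.2 * star (snapEntry k U q.2.1 q.2.2)) ∂ν

/-- The kernel `2 * secondMoment ν` of a unitary 3-design. -/
def intKernel : Matrix KernelIndex KernelIndex ℤ :=
  Matrix.of fun q p =>
    - 2 * (if p.1 = q.1 then 1 else 0) * (if p.2.1 = p.2.2 then 1 else 0)
        * (if q.2.1 = q.2.2 then 1 else 0)
    + (if q.2.1 = q.2.2 then 1 else 0) * (if p.1 = p.2.1 then 1 else 0)
        * (if p.2.2 = q.1 then 1 else 0)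
    + (if p.2.1 = p.2.2 then 1 else 0) * (if p.1 = q.2.2 then 1 else 0)
        * (if q.2.1 = q.1 then 1 else 0)
    + 3 * (if p.1 = q.1 then 1 else 0) * (if p.2.1 = q.2.1 then 1 else 0)
        * (if p.2.2 = q.2.2 then 1 else 0)

lemma intKernel_transpose : intKernelᵀ = intKernel := by decide +kernel

/-- On eigenvalues this reads `λ (λ - 1) (λ - 3) (λ - 4) = 0`, so the spectrum lies in `[0, 4]`.
Writing the relation as a sum of squares of symmetric matrices exhibits `intKernel` as positive
semidefinite; the next lemma does the same for `4 - intKernel`. -/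
lemma intKernel_sq : (12 : ℤ) • intKernel
    = (3 : ℤ) • (intKernel * intKernel) + (intKernel * (4 - intKernel)) * (intKernel * (4 - intKernel)) := by
  decide +kernel

lemma intKernel_compl_sq : (12 : ℤ) • (4 - intKernel) = (3 : ℤ) • ((4 - intKernel) * (4 - intKernel))
    + (intKernel * (4 - intKernel)) * (intKernel * (4 - intKernel)) := by
  decide +kernel

lemma integrable_rowProj_mul_snapEntry (ν : Measure U2) [IsProbabilityMeasure ν]
    (k a b x y x' y' : Fin 2) :
    Integrable (fun U => rowProj k U a b * (snapEntry k U x y * star (snapEntry k U x' y'))) ν := by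
  refine Integrable.of_bound (C := 1 * (4 * 4)) ((measurable_rowProj k a b).mul
    ((measurable_snapEntry k x y).mul (continuous_star.measurable.comp
      (measurable_snapEntry k x' y')))).aestronglyMeasurable
    (Filter.Eventually.of_forall fun U => ?_)
  rw [norm_mul, norm_mul, norm_star]
  gcongr
  · exact norm_rowProj_le _ _ _ _
  · exact norm_snapEntry_le _ _ _ _
  · exact norm_snapEntry_le _ _ _ _

/-- The two row projections add up to the identity. Substituting this for outcome 1 cancels the
cubic terms of the two outcomes, so only first and second moments of row 0 are needed. -/
lemma sum_rowProj_mul_snapEntry (U : U2) (a b x y x' y' : Fin 2) :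
    ∑ k, rowProj k U a b * (snapEntry k U x y * star (snapEntry k U x' y'))
      = (3 * (if x' = y' then 1 else 0)) * (rowProj 0 U a b * rowProj 0 U y x)
      + (3 * (if x = y then 1 else 0)) * (rowProj 0 U a b * rowProj 0 U x' y')
      + (9 * (if a = b then 1 else 0)) * (rowProj 0 U y x * rowProj 0 U x' y')
      + (-3 * (if x = y then 1 else 0) * (if x' = y' then 1 else 0)) * rowProj 0 U a b
      + (-6 * (if a = b then 1 else 0) * (if x' = y' then 1 else 0)) * rowProj 0 U y x
      + (-6 * (if a = b then 1 else 0) * (if x = y then 1 else 0)) * rowProj 0 U x' y'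
      + 4 * (if a = b then 1 else 0) * (if x = y then 1 else 0) * (if x' = y' then 1 else 0) := by
  have h1 : ∀ a b, rowProj 1 U a b = (if a = b then 1 else 0) - rowProj 0 U a b := fun a b => by
    rw [← sum_rowProj U a b]; ring
  have h2 : ∀ k, star (snapEntry k U x' y')
      = 3 * rowProj k U x' y' - if x' = y' then 1 else 0 := fun k => by
    rw [snapEntry, star_sub, star_mul', star_rowProj]
    split_ifs <;> simp
  simp only [Fin.sum_univ_two, h2]
  simp only [snapEntry, h1]
  rw [if_congr (eq_comm (a := y) (b := x)) rfl rfl]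
  ring

lemma integral_affine_combination {Ω : Type*} [MeasurableSpace Ω] {μ : Measure Ω}
    [IsProbabilityMeasure μ] {f₁ f₂ f₃ f₄ f₅ f₆ : Ω → ℂ} (h₁ : Integrable f₁ μ)
    (h₂ : Integrable f₂ μ) (h₃ : Integrable f₃ μ) (h₄ : Integrable f₄ μ) (h₅ : Integrable f₅ μ)
    (h₆ : Integrable f₆ μ) (c₁ c₂ c₃ c₄ c₅ c₆ c₇ : ℂ) :
    ∫ ω, (c₁ * f₁ ω + c₂ * f₂ ω + c₃ * f₃ ω + c₄ * f₄ ω + c₅ * f₅ ω + c₆ * f₆ ω + c₇) ∂μ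
      = c₁ * ∫ ω, f₁ ω ∂μ + c₂ * ∫ ω, f₂ ω ∂μ + c₃ * ∫ ω, f₃ ω ∂μ + c₄ * ∫ ω, f₄ ω ∂μ
        + c₅ * ∫ ω, f₅ ω ∂μ + c₆ * ∫ ω, f₆ ω ∂μ + c₇ := by
  have g₁ := h₁.const_mul c₁
  have g₂ := g₁.add (h₂.const_mul c₂)
  have g₃ := g₂.add (h₃.const_mul c₃)
  have g₄ := g₃.add (h₄.const_mul c₄)
  have g₅ := g₄.add (h₅.const_mul c₅)
  have g₆ := g₅.add (h₆.const_mul c₆)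
  have e₆ := integral_add g₆ (integrable_const (μ := μ) c₇)
  have e₅ := integral_add g₅ (h₆.const_mul c₆)
  have e₄ := integral_add g₄ (h₅.const_mul c₅)
  have e₃ := integral_add g₃ (h₄.const_mul c₄)
  have e₂ := integral_add g₂ (h₃.const_mul c₃)
  have e₁ := integral_add g₁ (h₂.const_mul c₂)
  simp only [Pi.add_apply, integral_const_mul] at e₁ e₂ e₃ e₄ e₅ e₆
  rw [e₆, e₅, e₄, e₃, e₂, e₁]
  simp

lemma IsUnitaryThreeDesign.secondMoment_eq {ν : Measure U2} (hν : IsUnitaryThreeDesign ν) :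
    secondMoment ν = (1 / 2 : ℂ) • intKernel.map (Int.castRingHom ℂ) := by
  have := hν.1
  ext ⟨b, x', y'⟩ ⟨a, x, y⟩
  simp only [secondMoment, of_apply, Matrix.smul_apply, Matrix.map_apply, smul_eq_mul]
  rw [← integral_finsetSum _ fun k _ => integrable_rowProj_mul_snapEntry ν k a b x y x' y']
  simp only [sum_rowProj_mul_snapEntry]
  have hm := fun a b c d => hν.rowMoment_eq 0 a b c d
  simp only [rowMoment] at hm
  rw [integral_affine_combination (integrable_rowProj_mul ν 0 a b y x)
    (integrable_rowProj_mul ν 0 a b x' y') (integrable_rowProj_mul ν 0 y x x' y')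
    (integrable_rowProj ν 0 a b) (integrable_rowProj ν 0 y x) (integrable_rowProj ν 0 x' y')]
  simp only [hm, hν.integral_rowProj, intKernel, of_apply]
  rw [if_congr (eq_comm (a := y) (b := x)) rfl rfl, if_congr (eq_comm (a := x') (b := x)) rfl rfl]
  simp only [map_add, map_mul, map_neg, apply_ite (Int.castRingHom ℂ), map_one, map_zero,
    map_ofNat]
  ring

lemma posSemidef_of_intKernel {X Y : Matrix KernelIndex KernelIndex ℤ} (hX : Xᵀ = X) (hY : Yᵀ = Y)
    {Z : Matrix KernelIndex KernelIndex ℤ} (h : (12 : ℤ) • Z = (3 : ℤ) • (X * X) + Y * Y) {r : ℝ} (hr : 0 ≤ r) :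
    ((r : ℂ) • Z.map (Int.castRingHom ℂ)).PosSemidef := by
  have hp : ∀ W : Matrix KernelIndex KernelIndex ℤ, Wᵀ = W →
      (W.map (Int.castRingHom ℂ) * W.map (Int.castRingHom ℂ)).PosSemidef := fun W hW => by
    have : (W.map (Int.castRingHom ℂ))ᴴ = W.map (Int.castRingHom ℂ) := by
      conv_rhs => rw [← hW]
      ext i j
      simp
    conv => enter [1, 1]; rw [← this]
    exact posSemidef_conjTranspose_mul_self _
  have h' : (r : ℂ) • Z.map (Int.castRingHom ℂ)
      = ((r / 4 : ℝ) : ℂ) • (X.map (Int.castRingHom ℂ) * X.map (Int.castRingHom ℂ))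
        + ((r / 12 : ℝ) : ℂ) • (Y.map (Int.castRingHom ℂ) * Y.map (Int.castRingHom ℂ)) := by
    rw [← Matrix.map_mul, ← Matrix.map_mul]
    ext i j
    have := congrArg (Int.castRingHom ℂ) (congrFun (congrFun h i) j)
    simp only [Matrix.smul_apply, Matrix.add_apply, smul_eq_mul, map_add, map_mul, map_ofNat]
      at this
    simp only [Matrix.smul_apply, Matrix.add_apply, smul_eq_mul, Matrix.map_apply]
    push_cast
    linear_combination (r / 12 : ℂ) * this
  rw [h']
  exact ((hp X hX).smul (Complex.zero_le_real.mpr (by positivity))).add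
    ((hp Y hY).smul (Complex.zero_le_real.mpr (by positivity)))

lemma IsUnitaryThreeDesign.posSemidef_secondMoment {ν : Measure U2} (hν : IsUnitaryThreeDesign ν) :
    (secondMoment ν).PosSemidef := by
  have h := posSemidef_of_intKernel intKernel_transpose (by decide +kernel) intKernel_sq
    (r := 1 / 2) (by norm_num)
  rw [hν.secondMoment_eq]
  simpa using h

/-- This is where the factor 2 per qubit, hence `2 ^ S.card` in all the variance bounds, originates.
-/
lemma IsUnitaryThreeDesign.posSemidef_sub_secondMoment {ν : Measure U2}
    (hν : IsUnitaryThreeDesign ν) :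
    (((2 : ℝ) : ℂ) • (1 : Matrix KernelIndex KernelIndex ℂ) - secondMoment ν).PosSemidef := by
  have h : ((2 : ℝ) : ℂ) • (1 : Matrix KernelIndex KernelIndex ℂ) - secondMoment ν
      = (1 / 2 : ℂ) • (4 - intKernel).map (Int.castRingHom ℂ) := by
    rw [hν.secondMoment_eq]
    ext i j
    by_cases hij : i = j <;> simp [Matrix.ofNat_apply, hij]; ring
  have h2 := posSemidef_of_intKernel (X := 4 - intKernel) (by decide +kernel) (by decide +kernel)
    intKernel_compl_sq (r := 1 / 2) (by norm_num)
  rw [h]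
  simpa using h2

/-! ### The law of one run -/

section RunLaw

set_option linter.unusedSectionVars false

variable {ι : Type} [Fintype ι] [DecidableEq ι]

lemma tensor_mul_mul_conjTranspose_apply (ρ : Op ι) (s : Record ι) :
    ((tensor fun i => (s.1 i).1) * ρ * (tensor fun i => (s.1 i).1)ᴴ) s.2 s.2
      = ∑ a, ∑ b, ρ a b * ∏ i, rowProj (s.2 i) (s.1 i) (a i) (b i) := by
  simp only [Matrix.mul_apply, conjTranspose_apply, tensor, of_apply, Finset.sum_mul, rowProj,
    Finset.prod_mul_distrib, star_prod]
  rw [Finset.sum_comm]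
  refine Finset.sum_congr rfl fun a _ => Finset.sum_congr rfl fun b _ => by ring

lemma bornProb_eq {ρ : Op ι} (hρ : ρ.PosSemidef) (s : Record ι) :
    ((bornProb ρ s : ℝ) : ℂ) = ∑ a, ∑ b, ρ a b * ∏ i, rowProj (s.2 i) (s.1 i) (a i) (b i) := by
  have h : 0 ≤ ((tensor fun i => (s.1 i).1) * ρ * (tensor fun i => (s.1 i).1)ᴴ) s.2 s.2 :=
    (hρ.mul_mul_conjTranspose_same (tensor fun i => (s.1 i).1)).diag_nonneg
  rw [← tensor_mul_mul_conjTranspose_apply]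
  exact Complex.ext rfl (Complex.nonneg_iff.mp h).2

lemma bornProb_nonneg {ρ : Op ι} (hρ : ρ.PosSemidef) (s : Record ι) : 0 ≤ bornProb ρ s :=
  (Complex.nonneg_iff.mp (hρ.mul_mul_conjTranspose_same _).diag_nonneg).1

lemma measurable_record {f : Record ι → ℂ} (hf : ∀ k, Measurable fun u : ι → U2 => f (u, k)) :
    Measurable f :=
  measurable_from_prod_countable_left hf

lemma measurable_prod_record {κ : Type*} [Fintype κ] {e : κ → ι} {g : κ → Fin 2 → U2 → ℂ}
    (hg : ∀ i k, Measurable (g i k)) :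
    Measurable fun s : Record ι => ∏ i, g i (s.2 (e i)) (s.1 (e i)) :=
  measurable_record fun _ => Finset.measurable_fun_prod _ fun i _ =>
    (hg i _).comp (measurable_pi_apply _)

lemma measurable_bornProb {ρ : Op ι} (hρ : ρ.PosSemidef) : Measurable (bornProb ρ) := by
  have h : bornProb ρ = fun s => (∑ a, ∑ b, ρ a b * ∏ i, rowProj (s.2 i) (s.1 i) (a i) (b i)).re := by
    funext s
    rw [← bornProb_eq hρ, Complex.ofReal_re]
  rw [h]
  refine Complex.measurable_re.comp (Finset.measurable_fun_sum _ fun a _ =>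
    Finset.measurable_fun_sum _ fun b _ => Measurable.const_mul ?_ _)
  exact measurable_prod_record (e := id) (g := fun i k U => rowProj k U (a i) (b i))
    fun i k => measurable_rowProj k _ _

variable {ν : ι → Measure U2} [∀ i, IsProbabilityMeasure (ν i)]

lemma integrable_prod_unitary {h : ι → U2 → ℂ} (hh : ∀ i, Integrable (h i) (ν i)) :
    Integrable (fun u : ι → U2 => ∏ i, h i (u i)) (Measure.pi ν) :=
  Integrable.fintype_prod_dep hh

lemma integrable_record {f : Record ι → ℂ}
    (hf : ∀ k, Integrable (fun u : ι → U2 => f (u, k)) (Measure.pi ν))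
    (hm : Measurable f) :
    Integrable f ((Measure.pi ν).prod Measure.count) :=
  (integrable_prod_iff' hm.aestronglyMeasurable).mpr
    ⟨Filter.Eventually.of_forall hf, Integrable.of_finite⟩

lemma integral_record {f : Record ι → ℂ}
    (hf : ∀ k, Integrable (fun u : ι → U2 => f (u, k)) (Measure.pi ν))
    (hm : Measurable f) :
    ∫ s, f s ∂((Measure.pi ν).prod Measure.count) = ∑ k, ∫ u, f (u, k) ∂(Measure.pi ν) := by
  rw [integral_prod_symm _ (integrable_record hf hm), integral_fintype Integrable.of_finite]
  simp

/-- The Born probability is linear in the entries of `ρ` with coefficients that are products over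
the qubits. For each pair of basis labels the integral therefore factorizes, even though an
entangled state makes the records of different qubits dependent. -/
lemma integral_bornProb_mul_prod {ρ : Op ι} (hρ : ρ.PosSemidef) {g : ι → Fin 2 → U2 → ℂ}
    (hg : ∀ i k, Measurable (g i k)) {C : ℝ} (hC : ∀ i k U, ‖g i k U‖ ≤ C) :
    Integrable (fun s : Record ι => ((bornProb ρ s : ℝ) : ℂ) * ∏ i, g i (s.2 i) (s.1 i))
      ((Measure.pi ν).prod Measure.count) ∧
    ∫ s : Record ι, ((bornProb ρ s : ℝ) : ℂ) * ∏ i, g i (s.2 i) (s.1 i)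
        ∂((Measure.pi ν).prod Measure.count)
      = ∑ a, ∑ b, ρ a b * ∏ i, ∑ k, ∫ U, rowProj k U (a i) (b i) * g i k U ∂(ν i) := by
  have h1 : ∀ (i : ι) (k a b : Fin 2), Integrable (fun U => rowProj k U a b * g i k U) (ν i) :=
    fun i k a b => (integrable_rowProj (ν i) k a b).mul_bdd (c := C)
      (hg i k).aestronglyMeasurable (Filter.Eventually.of_forall fun U => hC i k U)
  have h2 : ∀ (k : ι → Fin 2) (u : ι → U2), ((bornProb ρ (u, k) : ℝ) : ℂ) * ∏ i, g i (k i) (u i)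
      = ∑ a, ∑ b, ρ a b * ∏ i, (rowProj (k i) (u i) (a i) (b i) * g i (k i) (u i)) := by
    intro k u
    rw [bornProb_eq hρ]
    simp only [Finset.sum_mul, Finset.prod_mul_distrib]
    exact Finset.sum_congr rfl fun a _ => Finset.sum_congr rfl fun b _ => by ring
  have h3 : ∀ (k a b : ι → Fin 2), Integrable (fun u : ι → U2 => ρ a b *
      ∏ i, (rowProj (k i) (u i) (a i) (b i) * g i (k i) (u i))) (Measure.pi ν) := fun k a b =>
    (integrable_prod_unitary (h := fun i U => rowProj (k i) U (a i) (b i) * g i (k i) U)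
      fun i => h1 i (k i) _ _).const_mul _
  have h4 : ∀ k : ι → Fin 2, Integrable (fun u : ι → U2 => ((bornProb ρ (u, k) : ℝ) : ℂ) *
      ∏ i, g i (k i) (u i)) (Measure.pi ν) := fun k => by
    simp only [h2]
    exact integrable_finsetSum _ fun a _ => integrable_finsetSum _ fun b _ => h3 k a b
  have hm : Measurable fun s : Record ι => ((bornProb ρ s : ℝ) : ℂ) * ∏ i, g i (s.2 i) (s.1 i) :=
    (Complex.measurable_ofReal.comp (measurable_bornProb hρ)).mul
      (measurable_prod_record (e := id) hg)
  refine ⟨integrable_record h4 hm, ?_⟩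
  rw [integral_record h4 hm]
  simp only [h2]
  calc _ = ∑ k : ι → Fin 2, ∑ a, ∑ b, ρ a b *
        ∏ i, ∫ U, rowProj (k i) U (a i) (b i) * g i (k i) U ∂(ν i) := by
        refine Finset.sum_congr rfl fun k _ => ?_
        rw [integral_finsetSum _ fun a _ => integrable_finsetSum _ fun b _ => h3 k a b]
        refine Finset.sum_congr rfl fun a _ => ?_
        rw [integral_finsetSum _ fun b _ => h3 k a b]
        refine Finset.sum_congr rfl fun b _ => ?_
        rw [integral_const_mul, integral_fintype_prod_eq_prod
          (fun i U => rowProj (k i) U (a i) (b i) * g i (k i) U)]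
    _ = _ := by
        rw [Finset.sum_comm]
        refine Finset.sum_congr rfl fun a _ => ?_
        rw [Finset.sum_comm]
        refine Finset.sum_congr rfl fun b _ => ?_
        rw [← Finset.mul_sum, Finset.prod_univ_sum]
        simp

lemma integral_runLaw {ρ : Op ι} (hρ : ρ.PosSemidef) (f : Record ι → ℂ) :
    ∫ s, f s ∂(runLaw ν ρ)
      = ∫ s, ((bornProb ρ s : ℝ) : ℂ) * f s ∂((Measure.pi ν).prod Measure.count) := by
  rw [runLaw, integral_withDensity_eq_integral_toReal_smul
    (measurable_bornProb hρ).ennreal_ofReal (Filter.Eventually.of_forall fun s =>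
      ENNReal.ofReal_lt_top)]
  congr 1
  funext s
  rw [ENNReal.toReal_ofReal (bornProb_nonneg hρ s), Complex.real_smul]

lemma sum_mul_prod_ite (ρ : Op ι) :
    ∑ a, ∑ b, ρ a b * ∏ i, (if a i = b i then (1 : ℂ) else 0) = ρ.trace := by
  refine Finset.sum_congr rfl fun a _ => ?_
  rw [Finset.sum_eq_single a]
  · simp [diag]
  · intro b _ hb
    obtain ⟨i, hi⟩ := Function.ne_iff.mp hb
    rw [Finset.prod_eq_zero (Finset.mem_univ i), mul_zero]
    simp [Ne.symm hi]
  · simp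

end RunLaw

lemma isProbabilityMeasure_runLaw {ι : Type} [Fintype ι] [DecidableEq ι]
    {ν : ι → Measure U2} (hν : ∀ i, IsUnitaryThreeDesign (ν i)) {ρ : Op ι}
    (hρ : IsState ρ) : IsProbabilityMeasure (runLaw ν ρ) := by
  have := fun i => (hν i).1
  obtain ⟨h1, h2⟩ := integral_bornProb_mul_prod (ν := ν) hρ.1 (g := fun _ _ _ => 1)
    (fun _ _ => measurable_const) (C := 1) (fun _ _ _ => by simp)
  simp only [Finset.prod_const_one, mul_one, (hν _).sum_integral_rowProj, sum_mul_prod_ite,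
    hρ.2] at h1 h2
  constructor
  rw [runLaw, withDensity_apply _ MeasurableSet.univ, Measure.restrict_univ,
    ← ofReal_integral_eq_lintegral_ofReal (by simpa using h1.re)
      (Filter.Eventually.of_forall fun s => bornProb_nonneg hρ.1 s)]
  rw [integral_complex_ofReal] at h2
  rw [Complex.ofReal_eq_one.mp h2, ENNReal.ofReal_one]

/-! ### Snapshots of a subsystem -/

section Subsystem

set_option linter.unusedSectionVars false

variable {ι : Type} [Fintype ι] [DecidableEq ι]

lemma sum_glue (S : Finset ι) (f : (ι → Fin 2) → ℂ) :
    ∑ a, f a = ∑ x : S → Fin 2, ∑ z : {i // i ∉ S} → Fin 2, f (glue S x z) := by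
  rw [← Fintype.sum_prod_type']
  exact (Equiv.sum_comp (Equiv.piEquivPiSubtypeProd (· ∈ S) fun _ => Fin 2).symm f).symm

lemma reduced_eq_sum_submatrix (S : Finset ι) (ρ : Op ι) :
    reduced S ρ = ∑ z : {i // i ∉ S} → Fin 2,
      ρ.submatrix (fun x => glue S x z) (fun x => glue S x z) := by
  ext x y
  simp [reduced, Matrix.sum_apply]

lemma isState_reduced {ρ : Op ι} (hρ : IsState ρ) (S : Finset ι) : IsState (reduced S ρ) := by
  refine ⟨?_, ?_⟩
  · rw [reduced_eq_sum_submatrix]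
    exact posSemidef_sum _ fun z _ => hρ.1.submatrix _
  · rw [← hρ.2, Matrix.trace, Matrix.trace, sum_glue S]
    rfl

lemma prod_glue (S : Finset ι) (F : S → Fin 2 → Fin 2 → ℂ) (x y : S → Fin 2)
    (z w : {i // i ∉ S} → Fin 2) :
    ∏ i, (if h : i ∈ S then F ⟨i, h⟩ (glue S x z i) (glue S y w i)
      else if glue S x z i = glue S y w i then 1 else 0)
      = (∏ i, F i (x i) (y i)) * ∏ i, (if z i = w i then 1 else 0) := by
  rw [← Fintype.prod_subtype_mul_prod_subtype (fun i => i ∈ S)]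
  congr 1
  · refine Finset.prod_nbij' id id (by simp) (by simp) (by simp) (by simp) fun i _ => ?_
    simp [glue, i.2]
  · refine Finset.prod_nbij' id id (by simp) (by simp) (by simp) (by simp) fun i _ => ?_
    simp only [glue, i.2, dite_false, id]

lemma sum_reduced_mul_prod (S : Finset ι) (ρ : Op ι) (F : S → Fin 2 → Fin 2 → ℂ) :
    ∑ a, ∑ b, ρ a b * ∏ i, (if h : i ∈ S then F ⟨i, h⟩ (a i) (b i)
      else if a i = b i then 1 else 0)
      = ∑ x, ∑ y, reduced S ρ x y * ∏ i, F i (x i) (y i) := by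
  rw [sum_glue S]
  refine Finset.sum_congr rfl fun x _ => ?_
  simp only [sum_glue S (fun b => ρ _ b * _), prod_glue]
  rw [Finset.sum_comm]
  refine Finset.sum_congr rfl fun y _ => ?_
  simp only [reduced, of_apply, Finset.sum_mul]
  refine Finset.sum_congr rfl fun z _ => ?_
  rw [Finset.sum_eq_single z]
  · simp
  · intro w _ hw
    obtain ⟨i, hi⟩ := Function.ne_iff.mp hw
    rw [Finset.prod_eq_zero (i := i) (Finset.mem_univ i) (by simp [Ne.symm hi])]
    simp
  · simp

variable {ν : ι → Measure U2}

/-- Expectation of a product of functions of the single-qubit records in a subsystem. -/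
lemma integral_prod_runLaw (hν : ∀ i, IsUnitaryThreeDesign (ν i)) {ρ : Op ι}
    (hρ : ρ.PosSemidef) (S : Finset ι) {g : S → Fin 2 → U2 → ℂ}
    (hg : ∀ i k, Measurable (g i k)) {C : ℝ} (hC : ∀ i k U, ‖g i k U‖ ≤ C) :
    ∫ s : Record ι, ∏ i : S, g i (s.2 i) (s.1 i) ∂(runLaw ν ρ)
      = ∑ x, ∑ y, reduced S ρ x y *
        ∏ i : S, ∑ k, ∫ U, rowProj k U (x i) (y i) * g i k U ∂(ν i) := by
  have := fun i => (hν i).1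
  -- A qubit outside `S` carries the function 1, whose integral against the row projections is a
  -- Kronecker delta; these deltas perform the partial trace.
  set g' : ι → Fin 2 → U2 → ℂ := fun i => if h : i ∈ S then g ⟨i, h⟩ else fun _ _ => 1 with hg'
  have h1 : ∀ i k, Measurable (g' i k) := fun i k => by
    by_cases h : i ∈ S
    · simpa [hg', h] using hg ⟨i, h⟩ k
    · simp [hg', h]
  have h2 : ∀ i k U, ‖g' i k U‖ ≤ max C 1 := fun i k U => by
    by_cases h : i ∈ S
    · simpa [hg', h] using Or.inl (hC ⟨i, h⟩ k U)
    · simp [hg', h]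
  have h3 : ∀ s : Record ι, ∏ i : S, g i (s.2 i) (s.1 i) = ∏ i, g' i (s.2 i) (s.1 i) := fun s => by
    refine Fintype.prod_of_injective (Subtype.val : S → ι) Subtype.val_injective _ _
      (fun i hi => ?_) fun i => ?_
    · have : i ∉ S := by simpa using hi
      simp [hg', this]
    · simp [hg']
  simp only [h3]
  rw [integral_runLaw hρ, (integral_bornProb_mul_prod hρ h1 h2).2, ← sum_reduced_mul_prod S ρ
    fun i a b => ∑ k, ∫ U, rowProj k U a b * g i k U ∂(ν i)]
  refine Finset.sum_congr rfl fun a _ => Finset.sum_congr rfl fun b _ => ?_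
  congr 1
  refine Finset.prod_congr rfl fun i _ => ?_
  by_cases h : i ∈ S
  · simp [hg', h]
  · simpa [hg', h] using (hν i).sum_integral_rowProj (a i) (b i)

lemma snapshot_apply (S : Finset ι) (s : Record ι) (x y : S → Fin 2) :
    snapshot S s x y = ∏ i : S, snapEntry (s.2 i) (s.1 i) (x i) (y i) := by
  simp only [snapshot, tensor, of_apply, snapEntry_eq]

lemma measurable_snapshot (S : Finset ι) (x y : S → Fin 2) :
    Measurable fun s : Record ι => snapshot S s x y := by
  simp only [snapshot_apply]
  exact measurable_prod_record (e := Subtype.val)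
    (g := fun (i : S) k U => snapEntry k U (x i) (y i)) fun i k => measurable_snapEntry k _ _

lemma norm_snapshot_le (S : Finset ι) (s : Record ι) (x y : S → Fin 2) :
    ‖snapshot S s x y‖ ≤ 4 ^ S.card := by
  rw [snapshot_apply, norm_prod]
  refine (Finset.prod_le_prod (fun _ _ => norm_nonneg _)
    fun i _ => norm_snapEntry_le _ _ _ _).trans ?_
  simp

/-- The snapshot of a subsystem is unbiased. -/
lemma integral_snapshot (hν : ∀ i, IsUnitaryThreeDesign (ν i)) {ρ : Op ι}
    (hρ : ρ.PosSemidef) (S : Finset ι) (x y : S → Fin 2) :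
    ∫ s, snapshot S s x y ∂(runLaw ν ρ) = reduced S ρ x y := by
  simp only [snapshot_apply]
  rw [integral_prod_runLaw hν hρ S (g := fun (i : S) k U => snapEntry k U (x i) (y i))
    (fun i k => measurable_snapEntry k _ _) (fun i k U => norm_snapEntry_le k U _ _)]
  simp only [(hν _).sum_integral_rowProj_mul_snapEntry, Finset.prod_mul_distrib]
  rw [Finset.sum_eq_single x, Finset.sum_eq_single y]
  · simp
  · intro b _ hb
    obtain ⟨i, hi⟩ := Function.ne_iff.mp hb
    rw [Finset.prod_eq_zero (f := fun i => if b i = y i then (1 : ℂ) else 0) (i := i)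
      (Finset.mem_univ i) (by simp [hi])]
    simp
  · simp
  · intro b _ hb
    obtain ⟨i, hi⟩ := Function.ne_iff.mp hb
    rw [Finset.prod_eq_zero (f := fun i => if b i = x i then (1 : ℂ) else 0) (i := i)
      (Finset.mem_univ i) (by simp [hi])]
    simp
  · simp

lemma integral_snapshot_mul_star (hν : ∀ i, IsUnitaryThreeDesign (ν i)) {ρ : Op ι}
    (hρ : ρ.PosSemidef) (S : Finset ι) (x y x' y' : S → Fin 2) :
    ∫ s, snapshot S s x y * star (snapshot S s x' y') ∂(runLaw ν ρ)
      = ∑ a, ∑ b, reduced S ρ a b *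
        ∏ i : S, secondMoment (ν i) (b i, x' i, y' i) (a i, x i, y i) := by
  simp only [snapshot_apply, star_prod, ← Finset.prod_mul_distrib]
  rw [integral_prod_runLaw hν hρ S (g := fun (i : S) k U =>
      snapEntry k U (x i) (y i) * star (snapEntry k U (x' i) (y' i)))
    (fun i k => (measurable_snapEntry k _ _).mul
      (continuous_star.measurable.comp (measurable_snapEntry k _ _))) (C := 4 * 4)
    (fun i k U => by
      rw [norm_mul, norm_star]
      gcongr <;> exact norm_snapEntry_le _ _ _ _)]
  rfl

/-- Decompose `σ` as a sum of rank-one terms `B_j B_j†`. The left side becomes a sum over `j` of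
quadratic forms of the tensor product of the `secondMoment` matrices at the vectors `B_j ⊗ O`, whose
squared norms add up to `Tr σ * ‖O‖² = ‖O‖²`. -/
lemma re_sum_mul_prod_secondMoment_le {S : Finset ι} (hν : ∀ i, IsUnitaryThreeDesign (ν i))
    {σ : Op S} (hσ : IsState σ) (O : (S → Fin 2) × (S → Fin 2) → ℂ) :
    (∑ p, ∑ q, O p * star (O q) * ∑ a, ∑ b, σ a b *
        ∏ i : S, secondMoment (ν i) (b i, q.1 i, q.2 i) (a i, p.1 i, p.2 i)).re
      ≤ 2 ^ S.card * ∑ p, ‖O p‖ ^ 2 := by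
  obtain ⟨m, B, hB⟩ := posSemidef_iff_eq_sum_vecMulVec.mp hσ.1
  let e : (S → KernelIndex) ≃ (S → Fin 2) × (S → Fin 2) × (S → Fin 2) :=
    (Equiv.arrowProdEquivProdArrow S (fun _ => Fin 2) (fun _ => Fin 2 × Fin 2)).trans
      ((Equiv.refl _).prodCongr
        (Equiv.arrowProdEquivProdArrow S (fun _ => Fin 2) (fun _ => Fin 2)))
  let v : Fin m → (S → KernelIndex) → ℂ := fun j P => B j (e P).1 * O (e P).2
  have he : ∀ F : (S → Fin 2) → (S → Fin 2) × (S → Fin 2) → ℂ,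
      ∑ a, ∑ p, F a p = ∑ P, F (e P).1 (e P).2 := fun F => by
    rw [← Fintype.sum_prod_type', ← Equiv.sum_comp e]
  have h1 : ∑ p, ∑ q, O p * star (O q) * ∑ a, ∑ b, σ a b *
        ∏ i : S, secondMoment (ν i) (b i, q.1 i, q.2 i) (a i, p.1 i, p.2 i)
      = ∑ j, ∑ P, ∑ Q, v j P * star (v j Q) * ∏ i : S, secondMoment (ν i) (Q i) (P i) := by
    have h2 : ∀ j, ∑ P, ∑ Q, v j P * star (v j Q) * ∏ i : S, secondMoment (ν i) (Q i) (P i)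
        = ∑ a, ∑ p, ∑ b, ∑ q, (B j a * O p) * star (B j b * O q) *
          ∏ i : S, secondMoment (ν i) (b i, q.1 i, q.2 i) (a i, p.1 i, p.2 i) := fun j => by
      symm
      exact (he _).trans (Finset.sum_congr rfl fun P _ => (he _).trans rfl)
    simp only [h2]
    symm
    calc _ = ∑ j, ∑ p, ∑ q, ∑ a, ∑ b, (B j a * O p) * star (B j b * O q) *
          ∏ i : S, secondMoment (ν i) (b i, q.1 i, q.2 i) (a i, p.1 i, p.2 i) :=
          Finset.sum_congr rfl fun j _ => Finset.sum_comm.trans (Finset.sum_congr rfl fun p _ =>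
            (Finset.sum_congr rfl fun a _ => Finset.sum_comm).trans Finset.sum_comm)
      _ = ∑ p, ∑ q, ∑ a, ∑ b, ∑ j, (B j a * O p) * star (B j b * O q) *
          ∏ i : S, secondMoment (ν i) (b i, q.1 i, q.2 i) (a i, p.1 i, p.2 i) :=
          Finset.sum_comm.trans (Finset.sum_congr rfl fun p _ =>
            Finset.sum_comm.trans (Finset.sum_congr rfl fun q _ =>
            Finset.sum_comm.trans (Finset.sum_congr rfl fun a _ => Finset.sum_comm)))
      _ = _ := by
          refine Finset.sum_congr rfl fun p _ => Finset.sum_congr rfl fun q _ => ?_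
          simp only [Finset.mul_sum]
          refine Finset.sum_congr rfl fun a _ => Finset.sum_congr rfl fun b _ => ?_
          rw [hB]
          simp only [Matrix.sum_apply, vecMulVec_apply, Finset.mul_sum, Finset.sum_mul,
            Pi.star_apply]
          refine Finset.sum_congr rfl fun j _ => ?_
          rw [star_mul']
          ring
  have h3 : ∑ j, ∑ P, ‖v j P‖ ^ 2 = ∑ p, ‖O p‖ ^ 2 := by
    have h4 : ∀ j, ∑ P, ‖v j P‖ ^ 2 = (∑ a, ‖B j a‖ ^ 2) * ∑ p, ‖O p‖ ^ 2 := fun j => by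
      rw [Finset.sum_mul_sum, ← Fintype.sum_prod_type', ← Equiv.sum_comp e]
      refine Finset.sum_congr rfl fun P _ => ?_
      simp only [v, norm_mul, mul_pow]
    have h5 : ∑ j, ∑ a, ‖B j a‖ ^ 2 = 1 := by
      have h := hσ.2
      simp only [hB, Matrix.trace, diag_apply, Matrix.sum_apply, vecMulVec_apply,
        Pi.star_apply] at h
      rw [Finset.sum_comm] at h
      rw [← Complex.ofReal_inj, Complex.ofReal_one, ← h]
      push_cast
      refine Finset.sum_congr rfl fun j _ => Finset.sum_congr rfl fun a _ => ?_
      rw [← Complex.mul_conj']; rfl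
    simp only [h4]
    rw [← Finset.sum_mul, h5, one_mul]
  rw [h1, Complex.re_sum, ← h3, Finset.mul_sum]
  refine Finset.sum_le_sum fun j _ => ?_
  simpa using re_sum_piTensor_le (fun i : S => (hν i).posSemidef_secondMoment)
    (fun i => (hν i).posSemidef_sub_secondMoment) (v j)

lemma integrable_snapshot_mul_star (hν : ∀ i, IsUnitaryThreeDesign (ν i)) {ρ : Op ι}
    (hρ : IsState ρ) (S : Finset ι) (x y x' y' : S → Fin 2) :
    Integrable (fun s => snapshot S s x y * star (snapshot S s x' y')) (runLaw ν ρ) := by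
  have := isProbabilityMeasure_runLaw hν hρ
  refine Integrable.of_bound ((measurable_snapshot S x y).mul (continuous_star.measurable.comp
    (measurable_snapshot S x' y'))).aestronglyMeasurable (4 ^ S.card * 4 ^ S.card)
    (Filter.Eventually.of_forall fun s => ?_)
  rw [norm_mul, norm_star]
  gcongr <;> exact norm_snapshot_le _ _ _ _

/-- The second moment of a linear functional of a snapshot. -/
lemma integral_norm_sum_snapshot_sq_le (hν : ∀ i, IsUnitaryThreeDesign (ν i)) {ρ : Op ι}
    (hρ : IsState ρ) (S : Finset ι) (O : (S → Fin 2) × (S → Fin 2) → ℂ) :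
    ∫ s, ‖∑ p, O p * snapshot S s p.1 p.2‖ ^ 2 ∂(runLaw ν ρ)
      ≤ 2 ^ S.card * ∑ p, ‖O p‖ ^ 2 := by
  refine le_trans (le_of_eq ?_) (re_sum_mul_prod_secondMoment_le hν (isState_reduced hρ S) O)
  rw [← Complex.ofReal_re (∫ s, _ ∂_), ← integral_complex_ofReal]
  congr 1
  have h1 : ∀ s : Record ι, ((‖∑ p, O p * snapshot S s p.1 p.2‖ ^ 2 : ℝ) : ℂ)
      = ∑ p, ∑ q, O p * star (O q) * (snapshot S s p.1 p.2 * star (snapshot S s q.1 q.2)) := by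
    intro s
    rw [ofReal_norm_sum_sq]
    refine Finset.sum_congr rfl fun p _ => Finset.sum_congr rfl fun q _ => ?_
    rw [star_mul']; ring
  have h2 := fun p q : (S → Fin 2) × (S → Fin 2) =>
    (integrable_snapshot_mul_star hν hρ S p.1 p.2 q.1 q.2).const_mul (O p * star (O q))
  simp only [h1]
  rw [integral_finsetSum _ fun p _ => integrable_finsetSum _ fun q _ => h2 p q]
  refine Finset.sum_congr rfl fun p _ => ?_
  rw [integral_finsetSum _ fun q _ => h2 p q]
  refine Finset.sum_congr rfl fun q _ => ?_
  rw [integral_const_mul, integral_snapshot_mul_star hν hρ.1]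

/-- The partial transposition of matrix indices. -/
def transposeIndex (A S : Finset ι) :
    ((S → Fin 2) × (S → Fin 2)) ≃ ((S → Fin 2) × (S → Fin 2)) :=
  Function.Involutive.toPerm
    (fun p => (fun i => if i.1 ∈ A then p.2 i else p.1 i, fun i => if i.1 ∈ A then p.1 i else p.2 i))
    (fun p => by
      ext i
      · by_cases h : i.1 ∈ A <;> simp [h]
      · by_cases h : i.1 ∈ A <;> simp [h])

lemma partialTranspose_apply (A : Finset ι) {S : Finset ι} (X : Op S) (p : (S → Fin 2) × (S → Fin 2)) :
    partialTranspose A X p.1 p.2 = X (transposeIndex A S p).1 (transposeIndex A S p).2 := rfl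

lemma integral_norm_sub_sq_le {Ω : Type*} [MeasurableSpace Ω] {μ : Measure Ω}
    [IsProbabilityMeasure μ] {f : Ω → ℂ} (hf : Integrable f μ)
    (hf2 : Integrable (fun ω => ‖f ω‖ ^ 2) μ) :
    ∫ ω, ‖f ω - ∫ ω', f ω' ∂μ‖ ^ 2 ∂μ ≤ ∫ ω, ‖f ω‖ ^ 2 ∂μ := by
  set m := ∫ ω', f ω' ∂μ with hm
  have h1 : ∀ ω, ‖f ω - m‖ ^ 2 = ‖f ω‖ ^ 2 - 2 * (f ω * star m).re + ‖m‖ ^ 2 := fun ω => by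
    simp only [Complex.sq_norm, Complex.normSq_apply, Complex.sub_re, Complex.sub_im,
      Complex.mul_re, Complex.star_def, Complex.conj_re, Complex.conj_im]
    ring
  have h2 : Integrable (fun ω => 2 * (f ω * star m).re) μ := (hf.mul_const (star m)).re.const_mul 2
  have h3 : ∫ ω, (f ω * star m).re ∂μ = ‖m‖ ^ 2 := by
    have h4 := integral_re (hf.mul_const (star m))
    rw [integral_mul_const, ← hm] at h4
    refine h4.trans ?_
    change (m * (starRingEnd ℂ) m).re = _
    rw [Complex.mul_conj']
    norm_cast
  have h5 : Integrable (fun ω => ‖f ω‖ ^ 2 - 2 * (f ω * star m).re) μ := hf2.sub h2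
  simp only [h1]
  rw [integral_add h5 (integrable_const _), integral_sub hf2 h2, integral_const_mul, h3]
  simp only [integral_const, probReal_univ, one_smul]
  nlinarith [sq_nonneg ‖m‖]

/-- The deviation of a partially transposed snapshot from its mean. -/
def snapshotDeviation (A S : Finset ι) (ρ : Op ι) (s : Record ι) :
    (S → Fin 2) × (S → Fin 2) → ℂ :=
  fun p => partialTranspose A (snapshot S s) p.1 p.2
    - partialTranspose A (reduced S ρ) p.1 p.2

/-- For the variance, partial transposition is moved from the snapshot to the coefficients `O`,
where it permutes entries and keeps the norm; then the variance is bounded by the second moment. -/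
lemma isCentered_snapshotDeviation (hν : ∀ i, IsUnitaryThreeDesign (ν i)) {ρ : Op ι}
    (hρ : IsState ρ) (A S : Finset ι) :
    IsCentered (runLaw ν ρ) (snapshotDeviation A S ρ) (2 ^ S.card) := by
  have := isProbabilityMeasure_runLaw hν hρ
  have hi : ∀ x y, Integrable (fun s => snapshot S s x y) (runLaw ν ρ) := fun x y =>
    Integrable.of_bound (measurable_snapshot S x y).aestronglyMeasurable (4 ^ S.card)
      (Filter.Eventually.of_forall fun s => norm_snapshot_le _ _ _ _)
  constructor
  · intro p
    exact (measurable_snapshot S _ _).sub_const _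
  · obtain ⟨C, hC⟩ := (Set.finite_range fun p : (S → Fin 2) × (S → Fin 2) =>
      ‖reduced S ρ p.1 p.2‖).bddAbove
    have hC' : ∀ p : (S → Fin 2) × (S → Fin 2), ‖reduced S ρ p.1 p.2‖ ≤ C :=
      fun p => hC (Set.mem_range_self p)
    refine ⟨4 ^ S.card + C, fun s p => ?_⟩
    rw [snapshotDeviation, partialTranspose_apply, partialTranspose_apply]
    exact (norm_sub_le _ _).trans (add_le_add (norm_snapshot_le _ _ _ _) (hC' _))
  · intro p
    simp only [snapshotDeviation, partialTranspose_apply]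
    rw [integral_sub (hi _ _) (integrable_const _), integral_snapshot hν hρ.1]
    simp
  · intro O
    set f : Record ι → ℂ := fun s =>
      ∑ p, O ((transposeIndex A S).symm p) * snapshot S s p.1 p.2 with hf
    have h1 : ∀ s, ∑ p, O p * snapshotDeviation A S ρ s p
        = f s - ∫ s', f s' ∂(runLaw ν ρ) := fun s => by
      rw [hf, integral_finsetSum _ fun p _ => (hi p.1 p.2).const_mul _]
      simp only [integral_const_mul, integral_snapshot hν hρ.1]
      rw [← Finset.sum_sub_distrib, ← Equiv.sum_comp (transposeIndex A S) fun p =>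
        O ((transposeIndex A S).symm p) * snapshot S s p.1 p.2
          - O ((transposeIndex A S).symm p) * reduced S ρ p.1 p.2]
      refine Finset.sum_congr rfl fun p _ => ?_
      simp only [Equiv.symm_apply_apply, snapshotDeviation, partialTranspose_apply]
      ring
    simp only [h1]
    have hm : Measurable f := Finset.measurable_fun_sum _ fun p _ =>
      (measurable_snapshot S p.1 p.2).const_mul _
    have hb : ∀ s, ‖f s‖ ≤ ∑ p, ‖O ((transposeIndex A S).symm p)‖ * 4 ^ S.card := fun s =>
      (norm_sum_le _ _).trans (Finset.sum_le_sum fun p _ => by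
        rw [norm_mul]; gcongr; exact norm_snapshot_le _ _ _ _)
    refine (integral_norm_sub_sq_le (Integrable.of_bound hm.aestronglyMeasurable _
      (Filter.Eventually.of_forall hb)) (Integrable.of_bound (hm.norm.pow_const 2).aestronglyMeasurable
      ((∑ p, ‖O ((transposeIndex A S).symm p)‖ * 4 ^ S.card) ^ 2)
      (Filter.Eventually.of_forall fun s => ?_))).trans ?_
    · rw [norm_pow, norm_norm]
      gcongr
      exact hb s
    · refine (integral_norm_sum_snapshot_sq_le hν hρ S _).trans_eq ?_
      rw [Equiv.sum_comp (transposeIndex A S).symm fun p => ‖O p‖ ^ 2]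

end Subsystem

/-! ### Frobenius norm and partial transposition -/

/-- The squared Frobenius norm. -/
def frobSq {m n : Type*} [Fintype m] [Fintype n] (X : Matrix m n ℂ) : ℝ := ∑ p : m × n, ‖X p.1 p.2‖ ^ 2

lemma frobSq_nonneg {m n : Type*} [Fintype m] [Fintype n] (X : Matrix m n ℂ) : 0 ≤ frobSq X :=
  Finset.sum_nonneg fun _ _ => by positivity

lemma norm_sum_mul_sq_le {ι : Type*} (s : Finset ι) (f g : ι → ℂ) :
    ‖∑ i ∈ s, f i * g i‖ ^ 2 ≤ (∑ i ∈ s, ‖f i‖ ^ 2) * ∑ i ∈ s, ‖g i‖ ^ 2 := by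
  refine le_trans ?_ (Finset.sum_mul_sq_le_sq_mul_sq s (fun i => ‖f i‖) fun i => ‖g i‖)
  gcongr
  refine (norm_sum_le _ _).trans (le_of_eq ?_)
  simp

lemma frobSq_mul_le {l m n : Type*} [Fintype l] [Fintype m] [Fintype n] (X : Matrix l m ℂ)
    (Y : Matrix m n ℂ) : frobSq (X * Y) ≤ frobSq X * frobSq Y := by
  have hX : frobSq X = ∑ i, ∑ j, ‖X i j‖ ^ 2 := Fintype.sum_prod_type _
  have hY : frobSq Y = ∑ k, ∑ j, ‖Y j k‖ ^ 2 := Fintype.sum_prod_type_right _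
  rw [hX, hY, Finset.sum_mul_sum, ← Fintype.sum_prod_type']
  exact Finset.sum_le_sum fun p _ => norm_sum_mul_sq_le _ _ _

lemma norm_trace_mul_sq_le {m n : Type*} [Fintype m] [Fintype n] (X : Matrix m n ℂ)
    (Y : Matrix n m ℂ) : ‖(X * Y).trace‖ ^ 2 ≤ frobSq X * frobSq Y := by
  have h : (X * Y).trace = ∑ p : m × n, X p.1 p.2 * Y p.2 p.1 := by
    rw [Fintype.sum_prod_type]; rfl
  have hY : frobSq Y = ∑ p : m × n, ‖Y p.2 p.1‖ ^ 2 := by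
    rw [frobSq, ← Equiv.sum_comp (Equiv.prodComm m n)]; rfl
  rw [h, hY]
  exact norm_sum_mul_sq_le _ _ _

/-- Factor `σ` as `B B†`: both factors have squared Frobenius norm `Tr σ = 1`, and the norm is
submultiplicative. -/
lemma IsState.frobSq_le_one {ι : Type} [Fintype ι] [DecidableEq ι] {σ : Op ι} (hσ : IsState σ) :
    frobSq σ ≤ 1 := by
  obtain ⟨m, B, hB⟩ := posSemidef_iff_eq_sum_vecMulVec.mp hσ.1
  have h1 : σ = Matrix.of (fun a i => B i a) * Matrix.of (fun i b => star (B i b)) := by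
    rw [hB]
    ext a b
    simp [Matrix.sum_apply, vecMulVec_apply, Matrix.mul_apply]
  have h2 : frobSq (Matrix.of fun a i => B i a) = 1 := by
    have h := hσ.2
    simp only [hB, Matrix.trace, diag_apply, Matrix.sum_apply, vecMulVec_apply, Pi.star_apply] at h
    rw [frobSq, Fintype.sum_prod_type, ← Complex.ofReal_inj, Complex.ofReal_one, ← h]
    push_cast
    refine Finset.sum_congr rfl fun j _ => Finset.sum_congr rfl fun a _ => ?_
    rw [of_apply, ← Complex.mul_conj']; rfl
  have h3 : frobSq (Matrix.of fun i b => star (B i b)) = 1 := by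
    rw [← h2, frobSq, frobSq, ← Equiv.sum_comp (Equiv.prodComm _ _)]
    simp
  calc frobSq σ = _ := congrArg frobSq h1
    _ ≤ _ := frobSq_mul_le _ _
    _ = 1 := by rw [h2, h3, one_mul]

section PartialTranspose

variable {ι : Type} [DecidableEq ι] {S : Finset ι}

lemma frobSq_partialTranspose [Fintype ι] (A : Finset ι) (X : Op S) :
    frobSq (partialTranspose A X) = frobSq X := by
  simp only [frobSq, partialTranspose_apply]
  exact Equiv.sum_comp (transposeIndex A S) fun p => ‖X p.1 p.2‖ ^ 2

lemma isHermitian_partialTranspose (A : Finset ι) {X : Op S} (hX : X.IsHermitian) :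
    (partialTranspose A X).IsHermitian := by
  ext x y
  exact hX.apply _ _

lemma partialTranspose_empty (X : Op S) : partialTranspose ∅ X = X := by
  ext x y
  simp [partialTranspose]

end PartialTranspose

lemma trace_sq_of_isHermitian {n : Type*} [Fintype n] [DecidableEq n] {X : Matrix n n ℂ}
    (hX : X.IsHermitian) : (X ^ 2).trace = (frobSq X : ℂ) := by
  rw [frobSq, Fintype.sum_prod_type, pow_two]
  push_cast
  refine Finset.sum_congr rfl fun i _ => ?_
  rw [diag_apply, Matrix.mul_apply]
  refine Finset.sum_congr rfl fun j _ => ?_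
  rw [← hX.apply j i, ← Complex.mul_conj']
  rfl

/-! ### The three terms of the Hoeffding decomposition -/

section Forms

set_option linter.unusedSectionVars false

variable {κ : Type*} [Fintype κ] [DecidableEq κ] {Ω : Type*}

lemma sum_fin_succ_arrow {J M : Type*} [Fintype J] [AddCommMonoid M] {n : ℕ}
    (f : (Fin (n + 1) → J) → M) :
    ∑ p, f p = ∑ j, ∑ q : Fin n → J, f (Fin.cons j q) := by
  rw [← Fintype.sum_prod_type']
  exact (Equiv.sum_comp (Fin.consEquiv fun _ => J) f).symm

/-- Coefficients of `Δ ↦ Tr (R ^ 2 Δ)`. -/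
def linearCoeff (R : Matrix κ κ ℂ) (p : Fin 1 → κ × κ) : ℂ := (R * R) (p 0).2 (p 0).1

/-- Coefficients of `(Δ, Δ') ↦ Tr (R Δ Δ')`. -/
def quadraticCoeff (R : Matrix κ κ ℂ) (p : Fin 2 → κ × κ) : ℂ :=
  if (p 0).2 = (p 1).1 then R (p 1).2 (p 0).1 else 0

/-- Coefficients of `(Δ, Δ', Δ'') ↦ Tr (Δ Δ' Δ'')`. -/
def cubicCoeff (p : Fin 3 → κ × κ) : ℂ :=
  if (p 0).2 = (p 1).1 then if (p 1).2 = (p 2).1 then if (p 2).2 = (p 0).1 then 1 else 0 else 0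
  else 0

variable (D : Ω → κ × κ → ℂ) {m : Type*} (s : m → Ω)

lemma multiForm_linearCoeff (R : Matrix κ κ ℂ) (t : Fin 1 → m) :
    multiForm D (linearCoeff R) t s
      = (R * R * Matrix.of fun x y => D (s (t 0)) (x, y)).trace := by
  rw [multiForm, sum_fin_succ_arrow, Fintype.sum_prod_type_right]
  simp only [Matrix.trace, diag_apply, Matrix.mul_apply (M := R * R), of_apply]
  simp [linearCoeff]

lemma multiForm_quadraticCoeff (R : Matrix κ κ ℂ) (t : Fin 2 → m) :
    multiForm D (quadraticCoeff R) t s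
      = (R * (Matrix.of fun x y => D (s (t 0)) (x, y)) *
        Matrix.of fun x y => D (s (t 1)) (x, y)).trace := by
  simp only [multiForm, sum_fin_succ_arrow, Fintype.sum_prod_type]
  simp only [quadraticCoeff, Fin.cons_zero, Fin.cons_one, Fin.prod_univ_two, ite_mul, zero_mul,
    Finset.sum_ite_irrel, Finset.sum_const_zero, Finset.sum_ite_eq, Finset.mem_univ, if_true,
    Finset.univ_unique, Finset.sum_singleton]
  simp only [Matrix.trace, diag_apply, Matrix.mul_apply, of_apply, Finset.sum_mul]
  refine ((Finset.sum_congr rfl fun x _ => Finset.sum_comm).trans Finset.sum_comm).trans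
    (Finset.sum_congr rfl fun i _ => Finset.sum_comm.trans
    (Finset.sum_congr rfl fun j _ => Finset.sum_congr rfl fun k _ => ?_))
  ring

lemma multiForm_cubicCoeff (t : Fin 3 → m) :
    multiForm D cubicCoeff t s
      = ((Matrix.of fun x y => D (s (t 0)) (x, y)) * (Matrix.of fun x y => D (s (t 1)) (x, y)) *
        Matrix.of fun x y => D (s (t 2)) (x, y)).trace := by
  simp only [multiForm, sum_fin_succ_arrow, Fintype.sum_prod_type]
  have h2 : ∀ (a b c : κ × κ) (d : Fin 0 → κ × κ),
    (Fin.cons a (Fin.cons b (Fin.cons c d : Fin 1 → κ × κ) : Fin 2 → κ × κ) : Fin 3 → κ × κ) 2 = c :=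
    fun _ _ _ _ => rfl
  simp only [cubicCoeff, Fin.cons_zero, Fin.cons_one, Fin.prod_univ_three, ite_mul, zero_mul, h2,
    Finset.sum_ite_irrel, Finset.sum_const_zero, Finset.sum_ite_eq, Finset.sum_ite_eq', Finset.mem_univ, if_true,
    Finset.univ_unique, Finset.sum_singleton, one_mul]
  simp only [Matrix.trace, diag_apply, Matrix.mul_apply, of_apply, Finset.sum_mul]
  exact Finset.sum_congr rfl fun i _ => Finset.sum_comm

lemma sum_norm_linearCoeff_sq (R : Matrix κ κ ℂ) :
    ∑ p, ‖linearCoeff R p‖ ^ 2 = frobSq (R * R) := by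
  simp only [sum_fin_succ_arrow]
  rw [frobSq, ← Equiv.sum_comp (Equiv.prodComm κ κ)]
  simp [linearCoeff]

/-- The index shared by `Δ` and `Δ'` is free and contributes the dimension; the two outer indices
run over the entries of `R`. -/
lemma sum_norm_quadraticCoeff_sq (R : Matrix κ κ ℂ) :
    ∑ p, ‖quadraticCoeff R p‖ ^ 2 = Fintype.card κ * frobSq R := by
  simp only [sum_fin_succ_arrow, Fintype.sum_prod_type, frobSq]
  simp [quadraticCoeff, apply_ite]
  rw [← Finset.mul_sum, Finset.sum_comm]

lemma sum_norm_cubicCoeff_sq :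
    ∑ p : Fin 3 → κ × κ, ‖cubicCoeff p‖ ^ 2 = (Fintype.card κ : ℝ) ^ 3 := by
  simp only [sum_fin_succ_arrow, Fintype.sum_prod_type]
  have h2 : ∀ (a b c : κ × κ) (d : Fin 0 → κ × κ),
    (Fin.cons a (Fin.cons b (Fin.cons c d : Fin 1 → κ × κ) : Fin 2 → κ × κ) : Fin 3 → κ × κ) 2 = c :=
    fun _ _ _ _ => rfl
  simp [cubicCoeff, apply_ite, h2]
  ring

end Forms

/-! ### Expansion of the estimator into averaged forms -/

/-- Averages of multilinear forms over distinct sample points. -/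
def averageForm {Ω J : Type*} [Fintype J] {d M : ℕ} (D : Ω → J → ℂ) (H : (Fin d → J) → ℂ)
    (s : Fin M → Ω) : ℂ :=
  ((injTuples d M).card : ℂ)⁻¹ * ∑ t ∈ injTuples d M, multiForm D H t s

lemma averageForm_eq {Ω J : Type*} [Fintype J] {d e M : ℕ} (D : Ω → J → ℂ) (H : (Fin d → J) → ℂ)
    (s : Fin M → Ω) {f : Fin d → Fin e} (hf : Function.Injective f)
    (hd : (injTuples d M).card ≠ 0) (he : (injTuples e M).card ≠ 0) :
    ((injTuples e M).card : ℂ)⁻¹ * ∑ t ∈ injTuples e M, multiForm D H (t ∘ f) s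
      = averageForm D H s := by
  have h := card_mul_sum_injTuples_comp (M := M) hf fun t => multiForm D H t s
  have hd' : ((injTuples d M).card : ℂ) ≠ 0 := Nat.cast_ne_zero.mpr hd
  have he' : ((injTuples e M).card : ℂ) ≠ 0 := Nat.cast_ne_zero.mpr he
  rw [averageForm, inv_mul_eq_div, inv_mul_eq_div, div_eq_div_iff he' hd']
  linear_combination h

lemma IsCentered.integrable_norm_averageForm_sq {Ω J : Type*} [MeasurableSpace Ω] {μ : Measure Ω}
    [IsProbabilityMeasure μ] [Fintype J] {D : Ω → J → ℂ} {c : ℝ} (h : IsCentered μ D c)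
    {d M : ℕ} (H : (Fin d → J) → ℂ) :
    Integrable (fun s : Fin M → Ω => ‖averageForm D H s‖ ^ 2) (Measure.pi fun _ => μ) := by
  simp only [averageForm, norm_mul, mul_pow]
  exact (h.integrable_norm_sum_multiForm_sq H _).const_mul _

lemma IsCentered.integral_norm_averageForm_sq_le {Ω J : Type*} [MeasurableSpace Ω] {μ : Measure Ω}
    [IsProbabilityMeasure μ] [Fintype J] {D : Ω → J → ℂ} {c : ℝ} (h : IsCentered μ D c)
    (hc : 0 ≤ c) {d M : ℕ} (H : (Fin d → J) → ℂ) :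
    ∫ s : Fin M → Ω, ‖averageForm D H s‖ ^ 2 ∂(Measure.pi fun _ => μ)
      ≤ (d ^ d : ℕ) * (c ^ d * ∑ p, ‖H p‖ ^ 2) / (M.descFactorial d : ℕ) := by
  have h1 := h.integral_norm_sum_multiForm_sq_le hc H (injTuples d M) fun t => mem_injTuples.mp
  simp only [Fintype.card_fin, card_injTuples] at h1
  simp only [averageForm, norm_mul, mul_pow, norm_inv, Complex.norm_natCast, card_injTuples]
  rw [integral_const_mul]
  rcases Nat.eq_zero_or_pos (M.descFactorial d) with h0 | h0
  · simp [h0]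
  · have h2 : (0 : ℝ) < (M.descFactorial d : ℕ) := Nat.cast_pos.mpr h0
    rw [le_div_iff₀ h2]
    refine (mul_le_mul_of_nonneg_right (mul_le_mul_of_nonneg_left h1 (by positivity))
      h2.le).trans (le_of_eq ?_)
    field_simp

/-- Cyclicity of the trace moves every `R` to the front. The quadratic terms then involve the
ordered pairs `(X, Y)`, `(Y, Z)`, `(Z, X)`, which become indistinguishable after averaging over
distinct indices. -/
lemma trace_add_mul_add_mul_add {κ : Type*} [Fintype κ] (R X Y Z : Matrix κ κ ℂ) :
    ((R + X) * (R + Y) * (R + Z)).trace = (R * R * R).trace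
      + ((R * R * X).trace + (R * R * Y).trace + (R * R * Z).trace)
      + ((R * X * Y).trace + (R * Y * Z).trace + (R * Z * X).trace)
      + (X * Y * Z).trace := by
  have h1 : (R * X * R).trace = (R * R * X).trace := by rw [trace_mul_comm, ← mul_assoc]
  have h2 : (X * R * R).trace = (R * R * X).trace := by rw [mul_assoc, trace_mul_comm]
  have h3 : (R * Y * R).trace = (R * R * Y).trace := by rw [trace_mul_comm, ← mul_assoc]
  have h4 : (X * Y * R).trace = (R * X * Y).trace := by rw [trace_mul_comm, ← mul_assoc]
  have h5 : (X * R * Z).trace = (R * Z * X).trace := by rw [mul_assoc, trace_mul_comm]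
  simp only [mul_add, add_mul, trace_add, h2, h3, h4, h5]
  ring

section Estimator

variable {ι : Type} [Fintype ι] [DecidableEq ι]

lemma p3Estimator_sub_eq (A S : Finset ι) (ρ : Op ι) {M : ℕ} (hM : 3 ≤ M)
    (s : Fin M → Record ι) :
    p3Estimator A S s - ptMoment A S ρ 3
      = 3 * averageForm (snapshotDeviation A S ρ)
          (linearCoeff (partialTranspose A (reduced S ρ))) s
        + 3 * averageForm (snapshotDeviation A S ρ)
          (quadraticCoeff (partialTranspose A (reduced S ρ))) s
        + averageForm (snapshotDeviation A S ρ) cubicCoeff s := by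
  set R := partialTranspose A (reduced S ρ) with hR
  set D := snapshotDeviation A S ρ with hD
  have hcard : ∀ d ≤ 3, (injTuples d M).card ≠ 0 := fun d hd => by
    rw [card_injTuples]
    exact (Nat.descFactorial_pos.mpr (hd.trans hM)).ne'
  have h3 : ((injTuples 3 M).card : ℂ) ≠ 0 := Nat.cast_ne_zero.mpr (hcard 3 le_rfl)
  have hX : ∀ r, partialTranspose A (snapshot S (s r))
      = R + Matrix.of fun x y => D (s r) (x, y) := fun r => by
    ext x y
    simp [hD, snapshotDeviation, hR]
  have hexp : ∀ t : Fin 3 → Fin M, (partialTranspose A (snapshot S (s (t 0))) *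
      partialTranspose A (snapshot S (s (t 1))) * partialTranspose A (snapshot S (s (t 2)))).trace
      = (R ^ 3).trace
        + (multiForm D (linearCoeff R) (t ∘ ![0]) s + multiForm D (linearCoeff R) (t ∘ ![1]) s
          + multiForm D (linearCoeff R) (t ∘ ![2]) s)
        + (multiForm D (quadraticCoeff R) (t ∘ ![0, 1]) s
          + multiForm D (quadraticCoeff R) (t ∘ ![1, 2]) s
          + multiForm D (quadraticCoeff R) (t ∘ ![2, 0]) s)
        + multiForm D cubicCoeff t s := by
    intro t
    rw [hX, hX, hX, trace_add_mul_add_mul_add]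
    simp only [multiForm_linearCoeff, multiForm_quadraticCoeff, multiForm_cubicCoeff, pow_succ,
      pow_zero, one_mul]
    rfl
  rw [p3Estimator, cubicUStat_eq_average, ptMoment, ← hR]
  simp only [hexp, Finset.sum_add_distrib, mul_add, Finset.sum_const, nsmul_eq_mul]
  -- Each of the six lower-order sums uses only one or two entries of the triple, so it collapses to
  -- an average over shorter tuples; this yields the two factors 3.
  rw [averageForm_eq D _ s (by decide) (hcard 1 (by norm_num)) (hcard 3 le_rfl),
    averageForm_eq D _ s (by decide) (hcard 1 (by norm_num)) (hcard 3 le_rfl),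
    averageForm_eq D _ s (by decide) (hcard 1 (by norm_num)) (hcard 3 le_rfl),
    averageForm_eq D _ s (by decide) (hcard 2 (by norm_num)) (hcard 3 le_rfl),
    averageForm_eq D _ s (by decide) (hcard 2 (by norm_num)) (hcard 3 le_rfl),
    averageForm_eq D _ s (by decide) (hcard 2 (by norm_num)) (hcard 3 le_rfl),
    inv_mul_cancel_left₀ h3]
  have h4 : averageForm D cubicCoeff s
      = ((injTuples 3 M).card : ℂ)⁻¹ * ∑ t ∈ injTuples 3 M, multiForm D cubicCoeff t s := rfl
  rw [h4]
  ring

end Estimator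

/-! ### Chebyshev's inequality and the numerical constants -/

/-- Chebyshev's inequality for a sum of three terms. -/
lemma one_sub_le_measureReal_of_second_moments {Ω : Type*} [MeasurableSpace Ω] {P : Measure Ω}
    [IsProbabilityMeasure P] {a b c : Ω → ℂ} (ha : Integrable (fun ω => ‖a ω‖ ^ 2) P)
    (hb : Integrable (fun ω => ‖b ω‖ ^ 2) P) (hc : Integrable (fun ω => ‖c ω‖ ^ 2) P)
    {f : Ω → ℂ} (hf : ∀ ω, f ω = 3 * a ω + 3 * b ω + c ω) {ε δ : ℝ} (hε : 0 < ε)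
    (h : 27 * ∫ ω, ‖a ω‖ ^ 2 ∂P + 27 * ∫ ω, ‖b ω‖ ^ 2 ∂P + 3 * ∫ ω, ‖c ω‖ ^ 2 ∂P ≤ ε ^ 2 * δ) :
    1 - δ ≤ P.real {ω | ‖f ω‖ ≤ ε} := by
  set G : Ω → ℝ := fun ω => 27 * ‖a ω‖ ^ 2 + 27 * ‖b ω‖ ^ 2 + 3 * ‖c ω‖ ^ 2 with hG
  have hab : Integrable (fun ω => 27 * ‖a ω‖ ^ 2 + 27 * ‖b ω‖ ^ 2) P :=
    (ha.const_mul 27).add (hb.const_mul 27)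
  have hGi : Integrable G P := hab.add (hc.const_mul 3)
  have hGint : ∫ ω, G ω ∂P ≤ ε ^ 2 * δ := by
    rw [hG, integral_add hab (hc.const_mul 3), integral_add (ha.const_mul 27) (hb.const_mul 27),
      integral_const_mul, integral_const_mul, integral_const_mul]
    exact h
  have hmarkov := mul_meas_ge_le_integral_of_nonneg (μ := P) (f := G)
    (Filter.Eventually.of_forall fun ω => by positivity) hGi (ε ^ 2)
  have hbad : P.real {ω | ε ^ 2 ≤ G ω} ≤ δ :=
    le_of_mul_le_mul_left (hmarkov.trans hGint) (by positivity)
  -- A cover and subadditivity suffice, so measurability of the good event need not be shown. The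
  -- weights 27, 27, 3 in `G` come from `(x + y + z)² ≤ 3 (x² + y² + z²)` with `x = 3‖a‖`, `y =
  -- 3‖b‖`, `z = ‖c‖`.
  have hcover : (Set.univ : Set Ω) ⊆ {ω | ‖f ω‖ ≤ ε} ∪ {ω | ε ^ 2 ≤ G ω} := by
    intro ω _
    by_cases hω : ‖f ω‖ ≤ ε
    · exact Or.inl hω
    · right
      rw [not_le] at hω
      have h1 : ‖f ω‖ ≤ 3 * ‖a ω‖ + 3 * ‖b ω‖ + ‖c ω‖ := by
        rw [hf]
        refine (norm_add₃_le).trans (le_of_eq ?_)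
        simp
      have h2 : ε ^ 2 ≤ (3 * ‖a ω‖ + 3 * ‖b ω‖ + ‖c ω‖) ^ 2 := by
        gcongr
        exact hω.le.trans h1
      refine h2.trans ?_
      simp only [hG]
      nlinarith [sq_nonneg (3 * ‖a ω‖ - 3 * ‖b ω‖), sq_nonneg (3 * ‖a ω‖ - ‖c ω‖),
        sq_nonneg (3 * ‖b ω‖ - ‖c ω‖)]
  have h1 : (1 : ℝ) ≤ P.real {ω | ‖f ω‖ ≤ ε} + P.real {ω | ε ^ 2 ≤ G ω} := by
    calc (1 : ℝ) = P.real Set.univ := by simp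
      _ ≤ P.real ({ω | ‖f ω‖ ≤ ε} ∪ {ω | ε ^ 2 ≤ G ω}) := measureReal_mono hcover
      _ ≤ _ := measureReal_union_le _ _
  linarith

/-- The sample size condition, cleared of fractional powers. -/
lemma cube_le_of_sample_size {q ε δ m : ℝ} (hε : 0 < ε) (hδ : 0 < δ) (hq : 0 ≤ q)
    (h : 39 * (q / (ε ^ (2 / 3 : ℝ) * δ ^ (1 / 3 : ℝ))) ≤ m) :
    39 ^ 3 * q ^ 3 ≤ m ^ 3 * (ε ^ 2 * δ) := by
  have h1 : (ε ^ (2 / 3 : ℝ)) ^ 3 = ε ^ 2 := by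
    rw [← Real.rpow_natCast, ← Real.rpow_mul hε.le, ← Real.rpow_natCast]
    norm_num
  have h2 : (δ ^ (1 / 3 : ℝ)) ^ 3 = δ := by
    rw [← Real.rpow_natCast, ← Real.rpow_mul hδ.le]
    norm_num
  have h3 : 0 < ε ^ (2 / 3 : ℝ) * δ ^ (1 / 3 : ℝ) := by positivity
  rw [← mul_div_assoc, div_le_iff₀ h3] at h
  have h4 := pow_le_pow_left₀ (by positivity) h 3
  rw [mul_pow, mul_pow, mul_pow, h1, h2] at h4
  exact h4

/-- The numerators 4 and 27 are `d ^ d` for `d = 2, 3`. The constant 39 works because `27/39 +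
27·6/39² + 3·122/39³ < 1`. -/
lemma second_moment_bound {c p m η : ℝ} (hc : 1 ≤ c) (hm : 3 ≤ m) (hη : 0 < η)
    (h1 : 39 * (c * p ^ 2) ≤ m * η) (h3 : 39 ^ 3 * c ^ 6 ≤ m ^ 3 * η) :
    27 * (c * p ^ 2 / m) + 27 * (4 * (c ^ 3 * p) / (m * (m - 1)))
      + 3 * (27 * c ^ 6 / (m * (m - 1) * (m - 2))) ≤ η := by
  have hm0 : 0 < m := by linarith
  have e1 : c * p ^ 2 / m ≤ η / 39 := by
    rw [div_le_div_iff₀ hm0 (by norm_num)]; linarith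
  -- Geometric mean of `h1` and `h3`: their product bounds `39⁴ c⁷ p²` by `m⁴ η²`, with a spare
  -- factor `c ≥ 1`.
  have h2 : 39 ^ 2 * (c ^ 3 * p) ≤ m ^ 2 * η := by
    refine le_of_sq_le_sq ?_ (by positivity)
    have h4 : (39 * (c * p ^ 2)) * (39 ^ 3 * c ^ 6) ≤ (m * η) * (m ^ 3 * η) := by gcongr
    have h5 : c ^ 6 * p ^ 2 ≤ c ^ 7 * p ^ 2 := by
      exact mul_le_mul_of_nonneg_right (pow_le_pow_right₀ hc (by norm_num)) (by positivity)
    nlinarith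
  -- For `m ≥ 3`, `m / (m - 1) ≤ 3/2`, and `4 · 3/2 = 6`.
  have e2 : 4 * (c ^ 3 * p) / (m * (m - 1)) ≤ 6 * η / 39 ^ 2 := by
    rw [div_le_div_iff₀ (by nlinarith) (by norm_num)]
    nlinarith [mul_nonneg (mul_nonneg hm0.le (sub_nonneg.mpr hm)) hη.le]
  -- For `m ≥ 3`, `m³ / (m (m - 1) (m - 2)) ≤ 9/2`, with equality at 3, and `27 · 9/2 = 121.5`.
  have e3 : 27 * c ^ 6 / (m * (m - 1) * (m - 2)) ≤ 122 * η / 39 ^ 3 := by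
    have h6 : 2 * m ^ 3 ≤ 9 * (m * (m - 1) * (m - 2)) := by
      nlinarith [mul_nonneg (mul_nonneg hm0.le (sub_nonneg.mpr hm)) hm0.le,
        mul_nonneg hm0.le (sub_nonneg.mpr hm)]
    have h7 : 0 < m * (m - 1) * (m - 2) :=
      mul_pos (mul_pos hm0 (by linarith)) (by linarith)
    rw [div_le_div_iff₀ h7 (by norm_num)]
    nlinarith [mul_le_mul_of_nonneg_right h6 hη.le]
  linarith

/-! ### Sample complexity -/

section Main

variable {ι : Type} [Fintype ι] [DecidableEq ι]

/-- The partial transpose is Hermitian, so the trace of its square is its squared Frobenius norm,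
which partial transposition does not change. -/
lemma ptMoment_two {ρ : Op ι} (hρ : IsState ρ) (A S : Finset ι) :
    ptMoment A S ρ 2 = (frobSq (reduced S ρ) : ℂ) := by
  rw [ptMoment, trace_sq_of_isHermitian (isHermitian_partialTranspose A
    (isState_reduced hρ S).1.1), frobSq_partialTranspose]

/-- Needed for fewer than three runs, where the estimator is 0 and the error is the moment itself.
-/
lemma norm_ptMoment_three_le_one {ρ : Op ι} (hρ : IsState ρ) (A S : Finset ι) :
    ‖ptMoment A S ρ 3‖ ≤ 1 := by
  set R := partialTranspose A (reduced S ρ)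
  have h0 : frobSq R ≤ 1 := by
    rw [frobSq_partialTranspose]
    exact (isState_reduced hρ S).frobSq_le_one
  have h1 : ‖ptMoment A S ρ 3‖ ^ 2 ≤ 1 := by
    have h2 := norm_trace_mul_sq_le (R * R) R
    have h3 := frobSq_mul_le R R
    have h4 := frobSq_nonneg R
    have h5 : ptMoment A S ρ 3 = (R * R * R).trace := by rw [ptMoment, pow_succ, pow_two]
    rw [h5]
    calc _ ≤ frobSq (R * R) * frobSq R := h2
      _ ≤ (1 * 1) * 1 := by
        gcongr
        exact h3.trans (by gcongr)
      _ = 1 := by norm_num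
  exact (sq_le_one_iff₀ (norm_nonneg _)).mp h1

/-- The sample complexity of estimating third partial transpose moments. -/
lemma one_sub_le_p3Estimator_close {ν : ι → Measure U2} (hν : ∀ i, IsUnitaryThreeDesign (ν i))
    {ρ : Op ι} (hρ : IsState ρ) (A S : Finset ι) {ε δ : ℝ} (hε : 0 < ε) (hδ : 0 < δ) {M : ℕ}
    (h1 : 39 * ((2 : ℝ) ^ S.card * frobSq (reduced S ρ) ^ 2 / (ε ^ 2 * δ)) ≤ M)
    (h3 : 39 * ((2 : ℝ) ^ (2 * S.card) / (ε ^ (2 / 3 : ℝ) * δ ^ (1 / 3 : ℝ))) ≤ M) :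
    1 - δ ≤ (dataLaw ν ρ M).real
      {s | ‖p3Estimator A S s - ptMoment A S ρ 3‖ ≤ ε} := by
  have := isProbabilityMeasure_runLaw hν hρ
  have hP : IsProbabilityMeasure (dataLaw ν ρ M) := by unfold dataLaw; infer_instance
  set c : ℝ := 2 ^ S.card with hcdef
  have hc : 1 ≤ c := one_le_pow₀ (by norm_num)
  have h3' : 39 ^ 3 * c ^ 6 ≤ (M : ℝ) ^ 3 * (ε ^ 2 * δ) := by
    have := cube_le_of_sample_size hε hδ (by positivity) h3
    rwa [mul_comm 2 S.card, pow_mul, ← hcdef, ← pow_mul] at this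
  have h1' : 39 * (c * frobSq (reduced S ρ) ^ 2) ≤ M * (ε ^ 2 * δ) := by
    rwa [← mul_div_assoc, div_le_iff₀ (by positivity)] at h1
  rcases le_or_gt 1 δ with hδ1 | hδ1
  · exact (sub_nonpos.mpr hδ1).trans measureReal_nonneg
  rcases Nat.lt_or_ge M 3 with hM | hM
  -- With `M ≤ 2` and `δ < 1`, an `ε < 1` would give `39³ ≤ 39³ c⁶ ≤ M³ ε² δ ≤ 8`. So `ε ≥ 1`, and
  -- the value 0 is always close enough.
  · have hε1 : 1 ≤ ε := by
      by_contra! hlt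
      have hM2 : (M : ℝ) ≤ 2 := by exact_mod_cast Nat.le_of_lt_succ hM
      have h4 : (M : ℝ) ^ 3 ≤ 2 ^ 3 := by gcongr
      have h5 : ε ^ 2 * δ ≤ 1 * 1 := by
        gcongr
        exact pow_le_one₀ hε.le hlt.le
      have h6 : (M : ℝ) ^ 3 * (ε ^ 2 * δ) ≤ 2 ^ 3 * (1 * 1) := by gcongr
      have h7 : 1 ≤ c ^ 6 := one_le_pow₀ hc
      linarith
    have h0 : ∀ s : Fin M → Record ι, p3Estimator A S s = 0 := fun s => by
      simp [p3Estimator, cubicUStat, Nat.choose_eq_zero_of_lt hM]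
    have huniv : {s : Fin M → Record ι | ‖p3Estimator A S s - ptMoment A S ρ 3‖ ≤ ε}
        = Set.univ := by
      refine Set.eq_univ_of_forall fun s => ?_
      change ‖p3Estimator A S s - ptMoment A S ρ 3‖ ≤ ε
      rw [h0, zero_sub, norm_neg]
      exact (norm_ptMoment_three_le_one hρ A S).trans hε1
    rw [huniv, probReal_univ]
    linarith
  · have hD := isCentered_snapshotDeviation hν hρ A S
    set R := partialTranspose A (reduced S ρ) with hR
    set p := frobSq (reduced S ρ) with hp
    have hRp : frobSq R = p := frobSq_partialTranspose A _
    have hm : (3 : ℝ) ≤ M := by exact_mod_cast hM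
    have hc0 : 0 ≤ c := by linarith
    have hκ : (Fintype.card (S → Fin 2) : ℝ) = c := by simp [hcdef]
    have d1 : ((M.descFactorial 1 : ℕ) : ℝ) = M := by simp
    have d2 : ((M.descFactorial 2 : ℕ) : ℝ) = M * (M - 1) := by
      rw [Nat.descFactorial_succ, Nat.cast_mul, Nat.cast_sub (by omega), d1]
      push_cast; ring
    have d3 : ((M.descFactorial 3 : ℕ) : ℝ) = M * (M - 1) * (M - 2) := by
      rw [Nat.descFactorial_succ, Nat.cast_mul, Nat.cast_sub (by omega), d2]
      push_cast; ring
    have b1 := hD.integral_norm_averageForm_sq_le hc0 (M := M) (linearCoeff R)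
    have b2 := hD.integral_norm_averageForm_sq_le hc0 (M := M) (quadraticCoeff R)
    have b3 := hD.integral_norm_averageForm_sq_le hc0 (M := M)
      (cubicCoeff : (Fin 3 → (S → Fin 2) × (S → Fin 2)) → ℂ)
    rw [sum_norm_linearCoeff_sq, d1] at b1
    rw [sum_norm_quadraticCoeff_sq, d2, hκ, hRp] at b2
    rw [sum_norm_cubicCoeff_sq, d3, hκ] at b3
    have b1' : ∫ s : Fin M → Record ι, ‖averageForm (snapshotDeviation A S ρ) (linearCoeff R) s‖ ^ 2
        ∂(dataLaw ν ρ M) ≤ c * p ^ 2 / M := by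
      refine b1.trans ?_
      have h2 : frobSq (R * R) ≤ p ^ 2 := by
        rw [pow_two, ← hRp]; exact frobSq_mul_le R R
      refine div_le_div_of_nonneg_right ?_ (by linarith)
      simpa using mul_le_mul_of_nonneg_left h2 hc0
    refine one_sub_le_measureReal_of_second_moments (hD.integrable_norm_averageForm_sq _)
      (hD.integrable_norm_averageForm_sq _) (hD.integrable_norm_averageForm_sq _)
      (fun s => p3Estimator_sub_eq A S ρ hM s) hε ?_
    refine le_trans ?_ (second_moment_bound hc hm (by positivity) h1' h3')
    refine add_le_add (add_le_add ?_ ?_) ?_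
    · exact mul_le_mul_of_nonneg_left b1' (by norm_num)
    · refine mul_le_mul_of_nonneg_left (b2.trans (le_of_eq ?_)) (by norm_num)
      congr 1
      push_cast; ring
    · refine mul_le_mul_of_nonneg_left (b3.trans (le_of_eq ?_)) (by norm_num)
      congr 1
      push_cast; ring

end Main

end ClassicalShadow

end

theorem lemma4 (N : ℕ) (ν : Fin N → MeasureTheory.Measure ClassicalShadow.U2)
    (hν : ∀ i, ClassicalShadow.IsUnitaryThreeDesign (ν i))
    (ρ : ClassicalShadow.Op (Fin N)) (hρ : ClassicalShadow.IsState ρ)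
    (A B : Finset (Fin N)) (hAB : Disjoint A B)
    (ε δ : ℝ) (hε : 0 < ε) (hδ : 0 < δ)
    (p₂ : ℝ) (hp₂ : p₂ = (ClassicalShadow.ptMoment A (A ∪ B) ρ 2).re)
    (M : ℕ)
    (hM : 39 * max (max
          ((2 : ℝ) ^ (A ∪ B).card * p₂ ^ 2 / (ε ^ 2 * δ))
          ((2 : ℝ) ^ ((3 / 2 : ℝ) * (A ∪ B).card) * p₂ / (ε * Real.sqrt δ)))
          ((2 : ℝ) ^ (2 * (A ∪ B).card) / (ε ^ (2 / 3 : ℝ) * δ ^ (1 / 3 : ℝ))) ≤ (M : ℝ)) :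
    1 - δ ≤ (ClassicalShadow.dataLaw ν ρ M).real
        {s | ‖ClassicalShadow.p3Estimator A (A ∪ B) s
              - ClassicalShadow.ptMoment A (A ∪ B) ρ 3‖ ≤ ε} ∧
    1 - δ ≤ (ClassicalShadow.dataLaw ν ρ M).real
        {s | ‖ClassicalShadow.s3Estimator (A ∪ B) s
              - ((ClassicalShadow.reduced (A ∪ B) ρ) ^ 3).trace‖ ≤ ε} := by
  rw [ClassicalShadow.ptMoment_two hρ, Complex.ofReal_re] at hp₂
  subst hp₂
  have h1 := (mul_le_mul_of_nonneg_left ((le_max_left _ _).trans (le_max_left _ _))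
    (by norm_num : (0 : ℝ) ≤ 39)).trans hM
  have h3 := (mul_le_mul_of_nonneg_left (le_max_right _ _) (by norm_num : (0 : ℝ) ≤ 39)).trans hM
  refine ⟨ClassicalShadow.one_sub_le_p3Estimator_close hν hρ A (A ∪ B) hε hδ h1 h3, ?_⟩
  -- Transposing no qubit turns the PT-moment into the ordinary moment. The same `h1` applies
  -- because it mentions only the Frobenius norm of the reduced state.
  have h := ClassicalShadow.one_sub_le_p3Estimator_close hν hρ ∅ (A ∪ B) hε hδ h1 h3
  simpa only [ClassicalShadow.p3Estimator, ClassicalShadow.s3Estimator, ClassicalShadow.ptMoment,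
    ClassicalShadow.partialTranspose_empty] using h
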